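/- Let $d=d(n)\in\mathbb N$ and $p=p(n)\in[0,1]$ be sequences indexed by $n\in\mathbb N$. Assume that for each $n$ there is a real threshold $\tau_p$ such that $\mathbf P_{\mathbf x\sim\mathsf{Unif}(\{\pm1\}^d)}\big[\sum_{i=1}^d x_i\ge\tau_p\big]=p$, and let $\mathbf T_p:\{\pm1\}^d\to\{0,1\}$ be the hard-threshold connection $\mathbf T_p(\mathbf x)=\mathbb 1\big[\sum_{i=1}^d x_i\ge\tau_p\big]$. Let $\mathsf{RAG}(n,\{\pm1\}^d,p,\mathbf T_p)$ be the law of the random graph on $n$ vertices obtained by drawing $\mathbf x_1,\dots,\mathbf x_n$ independently and uniformly from the group $\{\pm1\}^d$ (with coordinatewise multiplication) and joining each pair $i<j$ independently with probability $\mathbf T_p(\mathbf x_i\mathbf x_j^{-1})$, that is, joining $i$ and $j$ if and only if $\langle\mathbf x_i,\mathbf x_j\rangle\ge\tau_p$. Let $\mathsf G(n,p)$ be the Erdős–Rényi law, in which each pair is an edge independently with probability $p$. Suppose that, as $n\to\infty$, $$d=\Omega(n\log n),\qquad d=\omega\Big(n^3p^2\log^2\tfrac1p\Big),$$ that $p$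 is polynomially bounded in $d$, i.e. there is a constant $C$ with $p\ge d^{-C}$ for all large $n$, and that $p$ is bounded away from $1$, i.e. there is a constant $c<1$ with $p\le c$ for all large $n$. Then $$\mathsf{KL}\Big(\mathsf{RAG}(n,\{\pm1\}^d,p,\mathbf T_p)\,\Big\|\,\mathsf G(n,p)\Big)\longrightarrow 0\qquad(n\to\infty).$$ -/

import Mathlib

open Filter Topology Asymptotics MeasureTheory
open scoped BigOperators

/-- The Boolean hypercube `{±1}^d`, a group under coordinatewise multiplication. -/
abbrev Hypercube (d : ℕ) : Type := Fin d → ℤˣ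

/-- The sum `x_1 + ⋯ + x_d` of the coordinates of a point of the hypercube. -/
def coordSum {d : ℕ} (x : Hypercube d) : ℝ := ∑ i, (((x i : ℤˣ) : ℤ) : ℝ)

/-- The hard-threshold connection `x ↦ 1[x_1 + ⋯ + x_d ≥ τ]` on the hypercube. -/
noncomputable def hardThreshold (d : ℕ) (τ : ℝ) (x : Hypercube d) : unitInterval :=
  open Classical in if τ ≤ coordSum x then 1 else 0

/-- `τ` is a threshold of density `p`: `P[x_1 + ⋯ + x_d ≥ τ] = p` for `x` uniform on `{±1}^d`. -/
def IsThreshold (d : ℕ) (p : unitInterval) (τ : ℝ) : Prop :=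
  open Classical in
  (Finset.card {x : Hypercube d | τ ≤ coordSum x} : ℝ) / (2 : ℝ) ^ d = p

/-- Conditional probability, given the latent vectors `x_1, …, x_n`, that the random algebraic
graph with connection `σ` equals `A`: the pairs `i < j` are edges independently of each other,
with probabilities `σ (x_i x_j⁻¹)`. -/
noncomputable def ragCondProb {Γ : Type*} [Group Γ] {n : ℕ} (σ : Γ → unitInterval) (x : Fin n → Γ)
    (A : SimpleGraph (Fin n)) : ℝ :=
  open Classical in
  ∏ e : Fin n × Fin n with e.1 < e.2,
    if A.Adj e.1 e.2 then (σ (x e.1 * (x e.2)⁻¹) : ℝ) else 1 - (σ (x e.1 * (x e.2)⁻¹) : ℝ)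

/-- The (right) random algebraic graph over a finite group `Γ` with connection `σ`, as a law on
graphs with vertex set `Fin n`. The latent vectors `x_1, …, x_n` are independent and uniform on
`Γ`, that is, `x` is uniform on `Fin n → Γ`, so `A` has mass `𝔼 x, ragCondProb σ x A`. For abelian
groups, such as the hypercube, left and right random algebraic graphs coincide. -/
noncomputable def RAG (n : ℕ) {Γ : Type*} [Group Γ] [Fintype Γ] (σ : Γ → unitInterval) :
    Measure (SimpleGraph (Fin n)) :=
  Measure.sum fun A => ENNReal.ofReal (𝔼 x : Fin n → Γ, ragCondProb σ x A) • Measure.dirac A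

/-! Expose the vertices one at a time. The chain rule for relative entropy, log u ≤ u − 1 and
Cauchy–Schwarz over the latent vectors bound the divergence by a sum over k < n of χ²-divergences:
that of the edges from a new vertex to k earlier ones, averaged over uniform latent vectors.
Squaring with two copies of the new latent vector turns the k-th term into E_g (1 + X(g))^k − 1,
where X(g) = (E_z σ(z)σ(zg) − p²)/(p(1 − p)) (`sum_ragProb_mul_log_le`, `sum_vertexProb_sq_div`).

For a threshold σ the correlation depends only on the number m of negative coordinates of g. Passing
from m to m + 1 lowers it by half the probability that x and xg both lie on the boundary slice in
dimension d − 1 (`ballPair_sub_succ`). This probability vanishes for odd m and varies slowly over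
central even m, so it is controlled by its mean, the squared mass of the slice (`slicePair_le`),
which a level-one inequality bounds by 8p²L/d with L = 1 − log p (`sliceProb_sq_le`). A typical g is
O(√d) steps from the centre and the correlation has mean p², so X(g) is of order pL/√d, up to a
factor with controlled exponential growth in |Σ g_i|/√d (`abs_ballPair_sub_sq_le`).

Since X has mean zero, E(1 + X)^k − 1 is of second order, O(n²p²L²/d), and summing over k gives
n³p²L²/d → 0. Atypical g have mass e^{−Ω(d)}, which beats (1 + X)^k ≤ 2^n because d/n → ∞
(`expect_one_add_pow_le`). -/

section DiscreteDivergence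

/-! ### Independent-edge laws on graphs, and divergence as a finite sum. -/

/-- Probability of `A` when the pairs `i < j` are independent edges of probabilities `q i j`. -/
noncomputable def edgeProb {n : ℕ} (q : Fin n → Fin n → ℝ) (A : SimpleGraph (Fin n)) : ℝ :=
  open Classical in
  ∏ e : Fin n × Fin n with e.1 < e.2, if A.Adj e.1 e.2 then q e.1 e.2 else 1 - q e.1 e.2

theorem ragCondProb_eq_edgeProb {Γ : Type*} [Group Γ] {n : ℕ} (σ : Γ → unitInterval)
    (x : Fin n → Γ) (A : SimpleGraph (Fin n)) :
    ragCondProb σ x A = edgeProb (fun i j => (σ (x i * (x j)⁻¹) : ℝ)) A := rfl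

theorem edgeProb_nonneg {n : ℕ} {q : Fin n → Fin n → ℝ} (h0 : ∀ i j, 0 ≤ q i j)
    (h1 : ∀ i j, q i j ≤ 1) (A : SimpleGraph (Fin n)) : 0 ≤ edgeProb q A := by
  classical
  refine Finset.prod_nonneg fun e _ => ?_
  split_ifs
  · exact h0 _ _
  · linarith [h1 e.1 e.2]

theorem edgeProb_pos {n : ℕ} {q : Fin n → Fin n → ℝ} (h0 : ∀ i j, 0 < q i j)
    (h1 : ∀ i j, q i j < 1) (A : SimpleGraph (Fin n)) : 0 < edgeProb q A := by
  classical
  refine Finset.prod_pos fun e _ => ?_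
  split_ifs
  · exact h0 _ _
  · linarith [h1 e.1 e.2]

/-- The probability that a Bernoulli variable of parameter `q` takes the value `b`. -/
def bernProb (q : ℝ) (b : Bool) : ℝ := if b then q else 1 - q

theorem prod_lt_succ {n : ℕ} (f : Fin (n + 1) → Fin (n + 1) → ℝ) :
    (∏ e : Fin (n + 1) × Fin (n + 1) with e.1 < e.2, f e.1 e.2) =
      (∏ e : Fin n × Fin n with e.1 < e.2, f e.1.castSucc e.2.castSucc) *
        ∏ i : Fin n, f i.castSucc (Fin.last n) := by
  rw [Finset.prod_filter, Finset.prod_filter, Fintype.prod_prod_type, Fintype.prod_prod_type,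
    Fin.prod_univ_castSucc]
  simp [Fin.prod_univ_castSucc, Finset.prod_mul_distrib, Fin.castSucc_lt_last,
    (Fin.castSucc_lt_last _).not_gt]

open Classical in
theorem edgeProb_succ {n : ℕ} (q : Fin (n + 1) → Fin (n + 1) → ℝ)
    (A : SimpleGraph (Fin (n + 1))) :
    edgeProb q A = edgeProb (fun i j => q i.castSucc j.castSucc) (A.comap Fin.castSucc) *
      ∏ i : Fin n, bernProb (q i.castSucc (Fin.last n)) (decide (A.Adj i.castSucc (Fin.last n))) := by
  unfold edgeProb bernProb
  rw [prod_lt_succ (fun i j => if A.Adj i j then q i j else 1 - q i j)]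
  simp

/-- A graph on `n + 1` vertices is a graph on the first `n` of them together with the
neighbourhood of the last one. -/
noncomputable def graphSuccEquiv (n : ℕ) :
    SimpleGraph (Fin (n + 1)) ≃ SimpleGraph (Fin n) × (Fin n → Bool) :=
  open Classical in
  { toFun A := (A.comap Fin.castSucc, fun i => decide (A.Adj i.castSucc (Fin.last n)))
    invFun B :=
      { Adj u v := Fin.lastCases (motive := fun _ => Prop)
          (Fin.lastCases (motive := fun _ => Prop) False (fun j => B.2 j = true) v)
          (fun i => Fin.lastCases (motive := fun _ => Prop) (B.2 i = true)
            (fun j => B.1.Adj i j) v) u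
        symm := ⟨by
          intro u v
          refine Fin.lastCases ?_ (fun i => ?_) u <;> refine Fin.lastCases ?_ (fun j => ?_) v <;>
            simp [B.1.adj_comm]⟩
        loopless := ⟨by
          intro u
          refine Fin.lastCases ?_ (fun i => ?_) u <;> simp⟩ }
    left_inv A := by
      ext u v
      refine Fin.lastCases ?_ (fun i => ?_) u <;> refine Fin.lastCases ?_ (fun j => ?_) v <;>
        simp [A.adj_comm]
    right_inv B := by
      ext u v <;> simp }

theorem sum_graph_succ {n : ℕ} (F : SimpleGraph (Fin n) → (Fin n → Bool) → ℝ) :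
    (open Classical in ∑ A : SimpleGraph (Fin (n + 1)),
      F (A.comap Fin.castSucc) (fun i => decide (A.Adj i.castSucc (Fin.last n)))) =
      open Classical in ∑ B, ∑ a, F B a := by
  classical
  rw [← Fintype.sum_prod_type']
  exact Fintype.sum_equiv (graphSuccEquiv n) _ _ fun A => rfl

theorem sum_prod_bernProb {n : ℕ} (q : Fin n → ℝ) :
    ∑ a : Fin n → Bool, ∏ i, bernProb (q i) (a i) = 1 := by
  rw [← Fintype.piFinset_univ, ← Finset.prod_univ_sum]
  simp [bernProb]

theorem sum_edgeProb {n : ℕ} (q : Fin n → Fin n → ℝ) :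
    (open Classical in ∑ A : SimpleGraph (Fin n), edgeProb q A) = 1 := by
  classical
  induction n with
  | zero => simp [edgeProb]
  | succ n ih =>
    simp_rw [edgeProb_succ]
    have := sum_graph_succ (n := n) fun B a => edgeProb (fun i j => q i.castSucc j.castSucc) B *
      ∏ i : Fin n, bernProb (q i.castSucc (Fin.last n)) (a i)
    convert this using 1
    simp_rw [← Finset.mul_sum, sum_prod_bernProb, mul_one]
    convert (ih _).symm

theorem ncard_edgeSet_eq {n : ℕ} (A : SimpleGraph (Fin n)) [DecidableRel A.Adj] :
    A.edgeSet.ncard = (Finset.univ.filter fun e : Fin n × Fin n => e.1 < e.2 ∧ A.Adj e.1 e.2).card := by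
  classical
  have : A.edgeSet = ((Finset.univ.filter fun e : Fin n × Fin n => e.1 < e.2 ∧ A.Adj e.1 e.2).image
      fun e => s(e.1, e.2) : Finset (Sym2 (Fin n))) := by
    ext e
    induction e with | h u v => ?_
    simp only [SimpleGraph.mem_edgeSet, Finset.coe_image, Finset.coe_filter, Finset.mem_univ,
      true_and, Set.mem_image, Set.mem_ofPred_eq, Prod.exists, Sym2.eq_iff]
    constructor
    · intro h
      rcases lt_trichotomy u v with h' | h' | h'
      · exact ⟨u, v, ⟨h', h⟩, Or.inl ⟨rfl, rfl⟩⟩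
      · exact absurd h' h.ne
      · exact ⟨v, u, ⟨h', h.symm⟩, Or.inr ⟨rfl, rfl⟩⟩
    · rintro ⟨a, b, ⟨_, h⟩, ⟨rfl, rfl⟩ | ⟨rfl, rfl⟩⟩
      · exact h
      · exact h.symm
  rw [this, Set.ncard_coe_finset, Finset.card_image_of_injOn]
  rintro ⟨a, b⟩ h ⟨a', b'⟩ h' heq
  simp only [Finset.coe_filter, Finset.mem_univ, true_and, Set.mem_ofPred_eq, Sym2.eq_iff] at h h' heq
  rcases heq with ⟨rfl, rfl⟩ | ⟨rfl, rfl⟩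
  · rfl
  · exact absurd h.1 h'.1.not_gt

theorem binomialRandom_singleton_eq_edgeProb {n : ℕ} (p : unitInterval) (A : SimpleGraph (Fin n)) :
    SimpleGraph.binomialRandom (Fin n) p {A} = ENNReal.ofReal (edgeProb (fun _ _ => (p : ℝ)) A) := by
  classical
  have h2 : (Nat.card (Fin n)).choose 2 = (Finset.univ.filter fun e : Fin n × Fin n => e.1 < e.2).card := by
    have := ncard_edgeSet_eq (⊤ : SimpleGraph (Fin n))
    rw [← SimpleGraph.coe_edgeFinset, Set.ncard_coe_finset,
      SimpleGraph.card_edgeFinset_top_eq_card_choose_two] at this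
    rw [Nat.card_eq_fintype_card, this]
    congr 1; ext e; simp +contextual [ne_of_lt]
  have h3 : (Finset.univ.filter fun e : Fin n × Fin n => e.1 < e.2).card - A.edgeSet.ncard =
      (Finset.univ.filter fun e : Fin n × Fin n => e.1 < e.2 ∧ ¬ A.Adj e.1 e.2).card := by
    rw [ncard_edgeSet_eq, ← Finset.filter_filter, ← Finset.filter_filter,
      ← Finset.card_filter_add_card_filter_not (s := Finset.univ.filter fun e : Fin n × Fin n => e.1 < e.2)
        (fun e => A.Adj e.1 e.2)]
    simp
  rw [SimpleGraph.binomialRandom_singleton, h2, h3, ncard_edgeSet_eq, edgeProb, Finset.prod_ite,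
    Finset.prod_const, Finset.prod_const, Finset.filter_filter, Finset.filter_filter,
    ENNReal.ofReal_mul (pow_nonneg p.2.1 _), ENNReal.ofReal_pow p.2.1,
    ENNReal.ofReal_pow (by linarith [p.2.2])]
  congr 2
  · rw [ENNReal.ofReal, unitInterval.toNNReal]
    congr 1
    ext; simp [p.2.1]; rfl
  · rw [ENNReal.ofReal, unitInterval.toNNReal]
    congr 1
    ext; simp [p.2.2]; rfl

/-- The first measure is `ν` with density P/Q, and the terms Q − P in `klFun` cancel in the sum
because the total masses agree. -/
theorem klDiv_sum_smul_dirac {α : Type*} [Fintype α] [MeasurableSpace α]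
    [MeasurableSingletonClass α] {P Q : α → ℝ} (hP : ∀ a, 0 ≤ P a) (hQ : ∀ a, 0 < Q a)
    (hPQ : ∑ a, P a = ∑ a, Q a) {ν : Measure α} [IsFiniteMeasure ν]
    (hν : ∀ a, ν {a} = ENNReal.ofReal (Q a)) :
    InformationTheory.klDiv (Measure.sum fun a => ENNReal.ofReal (P a) • Measure.dirac a) ν =
      ENNReal.ofReal (∑ a, P a * Real.log (P a / Q a)) := by
  classical
  have hμ : (Measure.sum fun a => ENNReal.ofReal (P a) • Measure.dirac a) =
      ν.withDensity fun a => ENNReal.ofReal (P a / Q a) := by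
    refine Measure.ext_of_singleton fun a => ?_
    rw [withDensity_apply _ (measurableSet_singleton a), Measure.sum_apply _ (measurableSet_singleton a),
      lintegral_singleton, hν, ← ENNReal.ofReal_mul (div_nonneg (hP a) (hQ a).le),
      div_mul_cancel₀ _ (hQ a).ne', tsum_fintype, Finset.sum_eq_single a]
    · simp
    · intro b _ hb
      simp [hb]
    · simp
  have : IsFiniteMeasure (ν.withDensity fun a => ENNReal.ofReal (P a / Q a)) := by
    refine isFiniteMeasure_withDensity ?_
    rw [lintegral_fintype]
    exact (ENNReal.sum_lt_top.2 fun a _ =>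
      ENNReal.mul_lt_top ENNReal.ofReal_lt_top (measure_lt_top _ _)).ne
  rw [hμ, InformationTheory.klDiv_eq_lintegral_klFun_of_ac (withDensity_absolutelyContinuous _ _)]
  have hm : Measurable fun a => ENNReal.ofReal (P a / Q a) := measurable_of_finite _
  have := Measure.rnDeriv_withDensity ν hm
  rw [lintegral_congr_ae (g := fun a => ENNReal.ofReal (InformationTheory.klFun (P a / Q a)))]
  · rw [lintegral_fintype]
    have key : ∀ a, ENNReal.ofReal (InformationTheory.klFun (P a / Q a)) * ν {a} =
        ENNReal.ofReal (P a * Real.log (P a / Q a) + Q a - P a) := fun a => by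
      rw [hν, ← ENNReal.ofReal_mul (InformationTheory.klFun_nonneg (div_nonneg (hP a) (hQ a).le)),
        InformationTheory.klFun]
      congr 1
      have := (hQ a).ne'
      field_simp
    simp_rw [key]
    rw [← ENNReal.ofReal_sum_of_nonneg]
    · congr 1
      rw [Finset.sum_sub_distrib, Finset.sum_add_distrib, hPQ]
      ring
    · intro a _
      have h := mul_nonneg (hQ a).le (InformationTheory.klFun_nonneg (div_nonneg (hP a) (hQ a).le))
      rw [InformationTheory.klFun] at h
      have := (hQ a).ne'
      field_simp at h
      linarith
  · filter_upwards [this] with a ha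
    rw [ha, ENNReal.toReal_ofReal (div_nonneg (hP a) (hQ a).le)]

end DiscreteDivergence

/-! ### Vertex exposure: from divergence to moments of the self-correlation of the connection. -/

section RandomAlgebraicGraph

variable {Γ : Type*} [Group Γ] [Fintype Γ]

theorem expect_snoc {α : Type*} [Fintype α] {n : ℕ} (F : (Fin (n + 1) → α) → ℝ) :
    𝔼 x, F x = 𝔼 x : Fin n → α, 𝔼 y, F (Fin.snoc (α := fun _ => α) x y) := by
  rw [Finset.expect_comm, ← Finset.expect_product', Finset.univ_product_univ]
  exact (Fintype.expect_equiv (Fin.snocEquiv fun _ => α) _ _ fun _ => rfl).symm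

theorem expect_prod_pi {α : Type*} [Fintype α] [Nonempty α] {n : ℕ} (f : α → ℝ) :
    𝔼 x : Fin n → α, ∏ i, f (x i) = (𝔼 z, f z) ^ n := by
  classical
  induction n with
  | zero => simp
  | succ n ih => simp [expect_snoc, Fin.prod_univ_castSucc, ← Finset.mul_expect,
     ← Finset.expect_mul, ih, pow_succ]

theorem sq_expect_mul_le {ι : Type*} [Fintype ι] (r F : ι → ℝ) (hr : ∀ i, 0 ≤ r i) :
    (𝔼 i, r i * F i) ^ 2 ≤ (𝔼 i, r i) * 𝔼 i, r i * F i ^ 2 := by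
  simp_rw [Fintype.expect_eq_sum_div_card, div_pow, div_mul_div_comm, ← sq]
  gcongr
  exact Finset.sum_sq_le_sum_mul_sum_of_sq_le_mul _ (fun i _ => hr i)
    (fun i _ => mul_nonneg (hr i) (sq_nonneg _)) fun i _ => le_of_eq (by ring)

/-- Law of the edges from a new vertex to vertices with latent vectors `x`. -/
noncomputable def vertexProb (σ : Γ → unitInterval) {n : ℕ} (x : Fin n → Γ) (a : Fin n → Bool) : ℝ :=
  𝔼 y, ∏ i, bernProb (σ (x i * y⁻¹)) (a i)

theorem bernProb_nonneg (q : unitInterval) (b : Bool) : 0 ≤ bernProb q b := by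
  unfold bernProb
  split_ifs
  · exact q.2.1
  · linarith [q.2.2]

theorem vertexProb_nonneg (σ : Γ → unitInterval) {n : ℕ} (x : Fin n → Γ) (a : Fin n → Bool) :
    0 ≤ vertexProb σ x a :=
  Finset.expect_nonneg fun _ _ => Finset.prod_nonneg fun _ _ => bernProb_nonneg _ _

theorem sum_vertexProb (σ : Γ → unitInterval) {n : ℕ} (x : Fin n → Γ) :
    ∑ a, vertexProb σ x a = 1 := by
  unfold vertexProb
  rw [← Finset.expect_sum_comm]
  simp_rw [sum_prod_bernProb]
  simp

/-- The mass function of `RAG`. -/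
noncomputable def ragProb {n : ℕ} (σ : Γ → unitInterval) (A : SimpleGraph (Fin n)) : ℝ :=
  𝔼 x : Fin n → Γ, ragCondProb σ x A

theorem ragCondProb_nonneg {Γ : Type*} [Group Γ] {n : ℕ} (σ : Γ → unitInterval) (x : Fin n → Γ)
    (A : SimpleGraph (Fin n)) : 0 ≤ ragCondProb σ x A :=
  edgeProb_nonneg (q := fun i j => (σ (x i * (x j)⁻¹) : ℝ)) (fun _ _ => (σ _).2.1)
    (fun _ _ => (σ _).2.2) A

theorem ragProb_nonneg {n : ℕ} (σ : Γ → unitInterval) (A : SimpleGraph (Fin n)) :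
    0 ≤ ragProb σ A :=
  Finset.expect_nonneg fun x _ => ragCondProb_nonneg σ x A

theorem sum_ragCondProb {Γ : Type*} [Group Γ] {n : ℕ} (σ : Γ → unitInterval) (x : Fin n → Γ) :
    (open Classical in ∑ A : SimpleGraph (Fin n), ragCondProb σ x A) = 1 :=
  sum_edgeProb fun i j => (σ (x i * (x j)⁻¹) : ℝ)

theorem sum_ragProb {n : ℕ} (σ : Γ → unitInterval) :
    (open Classical in ∑ A : SimpleGraph (Fin n), ragProb σ A) = 1 := by
  classical
  unfold ragProb
  rw [← Finset.expect_sum_comm]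
  have := fun x : Fin n → Γ => sum_ragCondProb σ x
  convert Finset.expect_const (s := (Finset.univ : Finset (Fin n → Γ))) Finset.univ_nonempty (1 : ℝ) using 2 with x
  convert this x

open Classical in
theorem ragProb_succ {n : ℕ} (σ : Γ → unitInterval) (A : SimpleGraph (Fin (n + 1))) :
    ragProb σ A = 𝔼 x : Fin n → Γ, ragCondProb σ x (A.comap Fin.castSucc) *
      vertexProb σ x fun i => decide (A.Adj i.castSucc (Fin.last n)) := by
  unfold ragProb vertexProb
  rw [expect_snoc]
  simp_rw [ragCondProb_eq_edgeProb, edgeProb_succ, Finset.mul_expect]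
  simp

/-- Replica computation: the square introduces two copies y, y' of the new latent vector. Given
them, the x_i are independent and the sum over a factorizes, so each coordinate contributes one
factor depending only on y y'⁻¹. -/
theorem sum_vertexProb_sq_div (σ : Γ → unitInterval) {p : ℝ} (hp0 : 0 < p) (hp1 : p < 1)
    (hσ : 𝔼 x, (σ x : ℝ) = p) (n : ℕ) :
    𝔼 x : Fin n → Γ, ∑ a, vertexProb σ x a ^ 2 / ∏ i, bernProb p (a i) =
      𝔼 g, (1 + (𝔼 z, (σ z : ℝ) * σ (z * g) - p ^ 2) / (p * (1 - p))) ^ n := by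
  have h1 : (1 - p) ≠ 0 := by linarith
  have e1 : ∀ x : Fin n → Γ, ∑ a, vertexProb σ x a ^ 2 / ∏ i, bernProb p (a i) =
      𝔼 y, 𝔼 y', ∏ i, ((σ (x i * y⁻¹) : ℝ) * σ (x i * y'⁻¹) / p +
        (1 - σ (x i * y⁻¹)) * (1 - σ (x i * y'⁻¹)) / (1 - p)) := by
    intro x
    have : ∀ a : Fin n → Bool, vertexProb σ x a ^ 2 / ∏ i, bernProb p (a i) =
        𝔼 y, 𝔼 y', ∏ i, bernProb (σ (x i * y⁻¹)) (a i) * bernProb (σ (x i * y'⁻¹)) (a i) /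
          bernProb p (a i) := by
      intro a
      simp_rw [Finset.prod_div_distrib, Finset.prod_mul_distrib, ← Finset.expect_div,
        ← Finset.mul_expect, ← Finset.expect_mul]
      rw [sq]; rfl
    simp_rw [this]
    rw [← Finset.expect_sum_comm]
    refine Finset.expect_congr rfl fun y _ => ?_
    rw [← Finset.expect_sum_comm]
    refine Finset.expect_congr rfl fun y' _ => ?_
    rw [← Fintype.piFinset_univ, ← Finset.prod_univ_sum (t := fun _ => Finset.univ)
      (f := fun i b => bernProb (σ (x i * y⁻¹)) b * bernProb (σ (x i * y'⁻¹)) b / bernProb p b)]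
    simp [bernProb]
  simp_rw [e1]
  rw [Finset.expect_comm]
  have e2 : ∀ y : Γ, 𝔼 x : Fin n → Γ, 𝔼 y', ∏ i, ((σ (x i * y⁻¹) : ℝ) * σ (x i * y'⁻¹) / p +
        (1 - σ (x i * y⁻¹)) * (1 - σ (x i * y'⁻¹)) / (1 - p)) =
      𝔼 g, (1 + (𝔼 z, (σ z : ℝ) * σ (z * g) - p ^ 2) / (p * (1 - p))) ^ n := by
    intro y
    rw [Finset.expect_comm]
    have e3 : ∀ y' : Γ, 𝔼 x : Fin n → Γ, ∏ i, ((σ (x i * y⁻¹) : ℝ) * σ (x i * y'⁻¹) / p +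
        (1 - σ (x i * y⁻¹)) * (1 - σ (x i * y'⁻¹)) / (1 - p)) =
        (1 + (𝔼 z, (σ z : ℝ) * σ (z * (y * y'⁻¹)) - p ^ 2) / (p * (1 - p))) ^ n := by
      intro y'
      rw [expect_prod_pi fun z => (σ (z * y⁻¹) : ℝ) * σ (z * y'⁻¹) / p +
        (1 - σ (z * y⁻¹)) * (1 - σ (z * y'⁻¹)) / (1 - p)]
      congr 1
      have e4 : 𝔼 z, ((σ (z * y⁻¹) : ℝ) * σ (z * y'⁻¹) / p +
          (1 - σ (z * y⁻¹)) * (1 - σ (z * y'⁻¹)) / (1 - p)) =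
          𝔼 z, ((σ z : ℝ) * σ (z * (y * y'⁻¹)) / (p * (1 - p)) + 1 / (1 - p) - σ z / (1 - p)
            - σ (z * (y * y'⁻¹)) / (1 - p)) := by
        refine Fintype.expect_equiv (Equiv.mulRight y⁻¹) _ _ fun z => ?_
        have : z * y⁻¹ * (y * y'⁻¹) = z * y'⁻¹ := by group
        simp only [Equiv.coe_mulRight, this]
        field_simp
        ring
      have e5 : 𝔼 z, (σ (z * (y * y'⁻¹)) : ℝ) = p := by
        rw [← hσ]
        exact Fintype.expect_equiv (Equiv.mulRight (y * y'⁻¹)) _ _ fun z => rfl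
      rw [e4, Finset.expect_sub_distrib, Finset.expect_sub_distrib, Finset.expect_add_distrib,
        ← Finset.expect_div, ← Finset.expect_div, ← Finset.expect_div, ← Finset.expect_div, e5, hσ,
        Finset.expect_const Finset.univ_nonempty]
      field_simp
      ring
    simp_rw [e3]
    -- For fixed y, the element g = y y'⁻¹ is uniform when y' is.
    exact Fintype.expect_equiv ((Equiv.inv Γ).trans (Equiv.mulLeft y)) _ _ fun z => rfl
  simp_rw [e2]
  exact Finset.expect_const Finset.univ_nonempty _

-- Each added vertex costs at most the χ²-divergence of its edge vector. Conditioning on the graph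
-- so far biases the latent vectors, but by convexity the posterior averages back to the uniform
-- law.
open Classical in
theorem sum_ragProb_mul_log_le (σ : Γ → unitInterval) {p : ℝ} (hp0 : 0 < p) (hp1 : p < 1)
    (hσ : 𝔼 x, (σ x : ℝ) = p) (n : ℕ) :
    ∑ A : SimpleGraph (Fin n), ragProb σ A * Real.log (ragProb σ A / edgeProb (fun _ _ => p) A) ≤
      ∑ k ∈ Finset.range n,
        (𝔼 g, (1 + (𝔼 z, (σ z : ℝ) * σ (z * g) - p ^ 2) / (p * (1 - p))) ^ k - 1) := by
  induction n with
  | zero => simp [ragProb, ragCondProb, edgeProb]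
  | succ n ih =>
    rw [Finset.sum_range_succ]
    set w : (Fin n → Bool) → ℝ := fun a => ∏ i, bernProb p (a i) with hw
    have hw0 : ∀ a, 0 < w a := fun a => Finset.prod_pos fun i _ => by
      unfold bernProb; split_ifs <;> linarith
    set R : SimpleGraph (Fin n) → (Fin n → Bool) → ℝ := fun B a =>
      𝔼 x : Fin n → Γ, ragCondProb σ x B * vertexProb σ x a with hR
    set q : SimpleGraph (Fin n) → ℝ := edgeProb fun _ _ => p with hq
    have hq0 : ∀ B, 0 < q B := edgeProb_pos (fun _ _ => hp0) fun _ _ => hp1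
    have hsplit : ∑ A : SimpleGraph (Fin (n + 1)),
        ragProb σ A * Real.log (ragProb σ A / edgeProb (fun _ _ => p) A) =
        ∑ B, ∑ a, R B a * Real.log (R B a / (q B * w a)) := by
      rw [← sum_graph_succ fun B a => R B a * Real.log (R B a / (q B * w a))]
      refine Finset.sum_congr rfl fun A _ => ?_
      rw [ragProb_succ, edgeProb_succ]
    have hR0 : ∀ B a, 0 ≤ R B a := fun B a => Finset.expect_nonneg fun x _ =>
      mul_nonneg (ragCondProb_nonneg σ x B) (vertexProb_nonneg σ x a)
    have hRsum : ∀ B, ∑ a, R B a = ragProb σ B := by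
      intro B
      simp only [hR]
      rw [← Finset.expect_sum_comm]
      simp_rw [← Finset.mul_sum, sum_vertexProb, mul_one]
      rfl
    -- The first summand is the old divergence in the chain rule; the second bounds the conditional
    -- divergence of the new edges.
    have hterm : ∀ B a, R B a * Real.log (R B a / (q B * w a)) ≤
        R B a * Real.log (ragProb σ B / q B) +
          ((𝔼 x : Fin n → Γ, ragCondProb σ x B * (vertexProb σ x a ^ 2 / w a)) - R B a) := by
      intro B a
      rcases (hR0 B a).eq_or_lt with h0 | h0
      · rw [← h0]
        simp only [zero_mul, zero_add, sub_zero]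
        exact Finset.expect_nonneg fun x _ => mul_nonneg (ragCondProb_nonneg σ x B)
          (div_nonneg (sq_nonneg _) (hw0 a).le)
      · have hP : 0 < ragProb σ B := by
          rw [← hRsum B]
          exact h0.trans_le (Finset.single_le_sum (f := R B) (fun a _ => hR0 B a) (Finset.mem_univ a))
        have e : R B a / (q B * w a) = ragProb σ B / q B * (R B a / (ragProb σ B * w a)) := by
          have := (hq0 B).ne'
          have := (hw0 a).ne'
          field_simp
        have hpos : 0 < R B a / (ragProb σ B * w a) := div_pos h0 (mul_pos hP (hw0 a))
        rw [e, Real.log_mul (div_pos hP (hq0 B)).ne' hpos.ne', mul_add]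
        gcongr
        refine (mul_le_mul_of_nonneg_left (Real.log_le_sub_one_of_pos hpos) h0.le).trans ?_
        rw [mul_sub, mul_one]
        gcongr
        -- Convexity of the square under the posterior of x given B, as Cauchy–Schwarz with weights
        -- `ragCondProb σ x B`.
        have hcs := sq_expect_mul_le (fun x : Fin n → Γ => ragCondProb σ x B)
          (fun x => vertexProb σ x a) fun x => ragCondProb_nonneg σ x B
        simp_rw [← mul_div_assoc, ← Finset.expect_div]
        have hwa := hw0 a
        rw [← sq, div_le_div_iff₀ (mul_pos hP hwa) hwa]
        calc R B a ^ 2 * w a ≤ (ragProb σ B * 𝔼 x : Fin n → Γ, ragCondProb σ x B * vertexProb σ x a ^ 2) * w a := by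
              gcongr
              exact hcs
          _ = _ := by ring
    rw [hsplit]
    calc ∑ B, ∑ a, R B a * Real.log (R B a / (q B * w a))
        ≤ ∑ B, ∑ a, (R B a * Real.log (ragProb σ B / q B) +
          ((𝔼 x : Fin n → Γ, ragCondProb σ x B * (vertexProb σ x a ^ 2 / w a)) - R B a)) :=
          Finset.sum_le_sum fun B _ => Finset.sum_le_sum fun a _ => hterm B a
      _ = ∑ B, ragProb σ B * Real.log (ragProb σ B / q B) +
          ((𝔼 x : Fin n → Γ, ∑ a, vertexProb σ x a ^ 2 / w a) - 1) := by
          simp_rw [Finset.sum_add_distrib, Finset.sum_sub_distrib, ← Finset.sum_mul, hRsum]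
          rw [sum_ragProb]
          congr 2
          -- Summed over B, the weights have total mass 1 for every x, so only the uniform average
          -- over x remains.
          simp_rw [← Finset.expect_sum_comm, ← Finset.mul_sum]
          refine Finset.expect_congr rfl fun x _ => ?_
          rw [← Finset.sum_mul, sum_ragCondProb, one_mul]
      _ ≤ _ := by
          rw [sum_vertexProb_sq_div σ hp0 hp1 hσ]
          gcongr

theorem klDiv_RAG_le (σ : Γ → unitInterval) {p : unitInterval} (hp0 : 0 < (p : ℝ))
    (hp1 : (p : ℝ) < 1) (hσ : 𝔼 x, (σ x : ℝ) = p) (n : ℕ) :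
    InformationTheory.klDiv (RAG n σ) (SimpleGraph.binomialRandom (Fin n) p) ≤
      ENNReal.ofReal (∑ k ∈ Finset.range n,
        (𝔼 g, (1 + (𝔼 z, (σ z : ℝ) * σ (z * g) - (p : ℝ) ^ 2) / (p * (1 - p))) ^ k - 1)) := by
  classical
  have : MeasurableSingletonClass (SimpleGraph (Fin n)) :=
    ⟨fun A => by
      have h := SimpleGraph.measurable_edgeSet (measurableSet_singleton A.edgeSet)
      rwa [← Set.image_singleton, Set.preimage_image_eq _ SimpleGraph.edgeSet_injective] at h⟩
  have h := klDiv_sum_smul_dirac (α := SimpleGraph (Fin n)) (P := ragProb σ)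
    (Q := edgeProb fun _ _ => (p : ℝ)) (ragProb_nonneg σ)
    (edgeProb_pos (fun _ _ => hp0) fun _ _ => hp1)
    ((sum_ragProb σ).trans (sum_edgeProb fun _ _ : Fin n => (p : ℝ)).symm)
    (binomialRandom_singleton_eq_edgeProb p)
  change InformationTheory.klDiv (Measure.sum fun A => ENNReal.ofReal (ragProb σ A) • Measure.dirac A) _ ≤ _
  rw [h]
  exact ENNReal.ofReal_le_ofReal (sum_ragProb_mul_log_le σ hp0 hp1 hσ n)

end RandomAlgebraicGraph

/-! ### Sub-Gaussian tails and parity on the hypercube. -/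

section HypercubeMoments

/-- The number of coordinates of `x` equal to `-1`. -/
def negCount {d : ℕ} (x : Hypercube d) : ℕ := (Finset.univ.filter fun i => x i = -1).card

theorem negCount_le {d : ℕ} (x : Hypercube d) : negCount x ≤ d :=
  (Finset.card_le_univ _).trans (by simp)

theorem coordSum_eq {d : ℕ} (x : Hypercube d) : coordSum x = d - 2 * negCount x := by
  have : ∀ u : ℤˣ, ((u : ℤ) : ℝ) = 1 - 2 * if u = -1 then 1 else 0 := by
    intro u
    rcases Int.units_eq_one_or u with rfl | rfl <;> norm_num
  simp only [coordSum, this, Finset.sum_sub_distrib, ← Finset.mul_sum, Finset.sum_boole, negCount]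
  simp

theorem expect_units_int (f : ℤˣ → ℝ) : 𝔼 u, f u = (f 1 + f (-1)) / 2 := by
  rw [Fintype.expect_eq_sum_div_card, UnitsInt.univ, Finset.sum_pair (by decide)]
  simp

theorem expect_exp_coordSum (d : ℕ) (r : ℝ) :
    𝔼 x : Hypercube d, Real.exp (r * coordSum x) = Real.cosh r ^ d := by
  have : ∀ x : Hypercube d, Real.exp (r * coordSum x) = ∏ i, Real.exp (r * ((x i : ℤ) : ℝ)) := by
    intro x
    rw [coordSum, Finset.mul_sum, Real.exp_sum]
  simp_rw [this]
  rw [expect_prod_pi fun u : ℤˣ => Real.exp (r * ((u : ℤ) : ℝ)), expect_units_int, Real.cosh_eq]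
  simp

theorem expect_exp_coordSum_le (d : ℕ) (r : ℝ) :
    𝔼 x : Hypercube d, Real.exp (r * coordSum x) ≤ Real.exp (r ^ 2 * d / 2) := by
  rw [expect_exp_coordSum]
  calc Real.cosh r ^ d ≤ Real.exp (r ^ 2 / 2) ^ d :=
        pow_le_pow_left₀ (Real.cosh_pos r).le (Real.cosh_le_exp_half_sq r) d
    _ = _ := by rw [← Real.exp_nat_mul]; ring_nf

theorem expect_exp_abs_coordSum_le (d : ℕ) (r : ℝ) :
    𝔼 x : Hypercube d, Real.exp (r * |coordSum x|) ≤ 2 * Real.exp (r ^ 2 * d / 2) := by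
  calc 𝔼 x : Hypercube d, Real.exp (r * |coordSum x|)
      ≤ 𝔼 x : Hypercube d, (Real.exp (r * coordSum x) + Real.exp (-r * coordSum x)) := by
        refine Finset.expect_le_expect fun x _ => ?_
        rcases abs_choice (coordSum x) with h | h <;> rw [h]
        · linarith [Real.exp_pos (-r * coordSum x)]
        · rw [mul_neg, ← neg_mul]
          linarith [Real.exp_pos (r * coordSum x)]
    _ ≤ _ := by
        rw [Finset.expect_add_distrib]
        have h1 := expect_exp_coordSum_le d r
        have h2 := expect_exp_coordSum_le d (-r)
        rw [neg_sq] at h2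
        linarith

open Classical in
theorem expect_le_abs_coordSum {d : ℕ} (hd : 0 < d) {R : ℝ} (hR : 0 ≤ R) :
    𝔼 x : Hypercube d, (if R ≤ |coordSum x| then (1 : ℝ) else 0) ≤
      2 * Real.exp (-(R ^ 2 / (2 * d))) := by
  have hd' : (0 : ℝ) < d := by exact_mod_cast hd
  calc 𝔼 x : Hypercube d, (if R ≤ |coordSum x| then (1 : ℝ) else 0)
      ≤ 𝔼 x : Hypercube d, Real.exp (-(R ^ 2 / d)) * Real.exp (R / d * |coordSum x|) := by
        refine Finset.expect_le_expect fun x _ => ?_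
        rw [← Real.exp_add]
        split_ifs with h
        · refine Real.one_le_exp ?_
          have : R / d * R ≤ R / d * |coordSum x| := by gcongr
          have e : R ^ 2 / d = R / d * R := by ring
          linarith
        · positivity
    _ ≤ Real.exp (-(R ^ 2 / d)) * (2 * Real.exp ((R / d) ^ 2 * d / 2)) := by
        rw [← Finset.mul_expect]
        gcongr
        exact expect_exp_abs_coordSum_le d _
    _ = _ := by
        rw [mul_left_comm, ← Real.exp_add]
        congr 2
        field_simp
        ring

open Classical in
theorem expect_le_mul_coordSum {d : ℕ} (hd : 0 < d) {R : ℝ} (hR : 0 ≤ R) {ε : ℝ} (hε : ε ^ 2 = 1) :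
    𝔼 x : Hypercube d, (if R ≤ ε * coordSum x then (1 : ℝ) else 0) ≤
      Real.exp (-(R ^ 2 / (2 * d))) := by
  have hd' : (0 : ℝ) < d := by exact_mod_cast hd
  calc 𝔼 x : Hypercube d, (if R ≤ ε * coordSum x then (1 : ℝ) else 0)
      ≤ 𝔼 x : Hypercube d, Real.exp (-(R ^ 2 / d)) * Real.exp ((ε * (R / d)) * coordSum x) := by
        refine Finset.expect_le_expect fun x _ => ?_
        rw [← Real.exp_add]
        split_ifs with h
        · refine Real.one_le_exp ?_
          have : R / d * R ≤ R / d * (ε * coordSum x) := by gcongr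
          have e : R ^ 2 / d = R / d * R := by ring
          linarith
        · positivity
    _ ≤ Real.exp (-(R ^ 2 / d)) * Real.exp ((ε * (R / d)) ^ 2 * d / 2) := by
        rw [← Finset.mul_expect]
        gcongr
        exact expect_exp_coordSum_le d _
    _ = _ := by
        rw [← Real.exp_add, mul_pow, hε]
        congr 1
        field_simp
        ring

-- Parity is the character ∏ x_i, which has mean zero once d > 0.
open Classical in
theorem expect_even_negCount {d : ℕ} (hd : 0 < d) :
    𝔼 x : Hypercube d, (if Even (negCount x) then (1 : ℝ) else 0) = 1 / 2 := by
  have key : ∀ x : Hypercube d, (if Even (negCount x) then (1 : ℝ) else 0) =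
      (1 + ∏ i, ((x i : ℤ) : ℝ)) / 2 := by
    intro x
    have : ∀ u : ℤˣ, ((u : ℤ) : ℝ) = if u = -1 then -1 else 1 := by
      intro u
      rcases Int.units_eq_one_or u with rfl | rfl <;> simp
    have h : ∏ i, ((x i : ℤ) : ℝ) = (-1) ^ negCount x := by
      simp_rw [this]
      rw [Finset.prod_ite]
      simp [negCount]
    rw [h]
    split_ifs with he
    · rw [he.neg_one_pow]; norm_num
    · rw [(Nat.not_even_iff_odd.1 he).neg_one_pow]; norm_num
  simp_rw [key]
  rw [← Finset.expect_div, Finset.expect_add_distrib, Fintype.expect_const,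
    expect_prod_pi fun u : ℤˣ => ((u : ℤ) : ℝ), expect_units_int]
  simp [hd.ne']

theorem negCount_snoc {d : ℕ} (x : Hypercube d) (u : ℤˣ) :
    negCount (Fin.snoc (α := fun _ => ℤˣ) x u : Hypercube (d + 1)) =
      negCount x + if u = -1 then 1 else 0 := by
  simp only [negCount, Finset.card_filter, Fin.sum_univ_castSucc, Fin.snoc_castSucc, Fin.snoc_last]

end HypercubeMoments

/-! ### Joint law of the negative counts of x and xg, through commuting operators. -/

section PairOperators

/-- Shift of the first argument. -/
noncomputable def shiftFst : Module.End ℝ (ℕ × ℕ → ℝ) :=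
  LinearMap.funLeft ℝ ℝ fun c => (c.1 + 1, c.2)

/-- Shift of the second argument. -/
noncomputable def shiftSnd : Module.End ℝ (ℕ × ℕ → ℝ) :=
  LinearMap.funLeft ℝ ℝ fun c => (c.1, c.2 + 1)

/-- Average over one coordinate on which the two points agree. -/
noncomputable def avgSame : Module.End ℝ (ℕ × ℕ → ℝ) :=
  (1 / 2 : ℝ) • (shiftFst * shiftSnd + 1)

/-- Average over one coordinate on which the two points differ. -/
noncomputable def avgFlip : Module.End ℝ (ℕ × ℕ → ℝ) :=
  (1 / 2 : ℝ) • (shiftFst + shiftSnd)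

theorem avgSame_apply (f : ℕ × ℕ → ℝ) (a b : ℕ) :
    avgSame f (a, b) = (f (a, b) + f (a + 1, b + 1)) / 2 := by
  simp [avgSame, shiftFst, shiftSnd, LinearMap.funLeft_apply]
  ring

theorem avgFlip_apply (f : ℕ × ℕ → ℝ) (a b : ℕ) :
    avgFlip f (a, b) = (f (a + 1, b) + f (a, b + 1)) / 2 := by
  simp [avgFlip, shiftFst, shiftSnd, LinearMap.funLeft_apply]
  ring

theorem commute_shift : Commute shiftFst shiftSnd := by
  ext f c
  rfl

theorem commute_avg : Commute avgSame avgFlip := by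
  unfold avgSame avgFlip
  refine ((Commute.smul_left ?_ _).smul_right _)
  refine Commute.add_left ?_ (Commute.one_left _)
  refine Commute.add_right ?_ ?_
  · exact (Commute.refl _).mul_left commute_shift.symm
  · exact commute_shift.mul_left (Commute.refl _)

theorem shiftFst_pow_apply (j : ℕ) (f : ℕ × ℕ → ℝ) (a b : ℕ) :
    (shiftFst ^ j) f (a, b) = f (a + j, b) := by
  induction j generalizing a with
  | zero => simp
  | succ j ih =>
    rw [pow_succ', Module.End.mul_apply]
    change (shiftFst ^ j) f (a + 1, b) = _
    rw [ih]
    congr 2; ring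

theorem shiftSnd_pow_apply (j : ℕ) (f : ℕ × ℕ → ℝ) (a b : ℕ) :
    (shiftSnd ^ j) f (a, b) = f (a, b + j) := by
  induction j generalizing b with
  | zero => simp
  | succ j ih =>
    rw [pow_succ', Module.End.mul_apply]
    change (shiftSnd ^ j) f (a, b + 1) = _
    rw [ih]
    congr 2; ring

theorem avgFlip_pow_apply (m : ℕ) (f : ℕ × ℕ → ℝ) (a b : ℕ) :
    (avgFlip ^ m) f (a, b) =
      (1 / 2) ^ m * ∑ j ∈ Finset.range (m + 1), m.choose j * f (a + j, b + (m - j)) := by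
  rw [avgFlip, smul_pow, commute_shift.add_pow, LinearMap.smul_apply, Pi.smul_apply, smul_eq_mul,
    LinearMap.sum_apply, Finset.sum_apply]
  congr 1
  refine Finset.sum_congr rfl fun j _ => ?_
  rw [← nsmul_eq_mul', LinearMap.smul_apply, Pi.smul_apply, Module.End.mul_apply, shiftFst_pow_apply,
    shiftSnd_pow_apply, nsmul_eq_mul]

theorem avgSame_pow_apply (r : ℕ) (f : ℕ × ℕ → ℝ) (a b : ℕ) :
    (avgSame ^ r) f (a, b) =
      (1 / 2) ^ r * ∑ i ∈ Finset.range (r + 1), r.choose i * f (a + i, b + i) := by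
  rw [avgSame, smul_pow, (Commute.one_right _).add_pow, LinearMap.smul_apply, Pi.smul_apply,
    smul_eq_mul, LinearMap.sum_apply, Finset.sum_apply]
  congr 1
  refine Finset.sum_congr rfl fun j _ => ?_
  rw [← nsmul_eq_mul', LinearMap.smul_apply, Pi.smul_apply, one_pow, mul_one, commute_shift.mul_pow,
    Module.End.mul_apply, shiftFst_pow_apply, shiftSnd_pow_apply, nsmul_eq_mul]

/-- Each coordinate acts on the pair of counts by `avgSame` or `avgFlip` according to the sign of g
there. These commute, so only the number of negative coordinates of g matters. -/
theorem expect_pair {d : ℕ} (g : Hypercube d) (f : ℕ × ℕ → ℝ) (a b : ℕ) :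
    𝔼 x : Hypercube d, f (a + negCount x, b + negCount (x * g)) =
      (avgSame ^ (d - negCount g) * avgFlip ^ negCount g) f (a, b) := by
  induction d generalizing f with
  | zero =>
    have : ∀ x : Hypercube 0, negCount x = 0 := fun x => by simp [negCount]
    simp [this]
  | succ d ih =>
    obtain ⟨g, u, rfl⟩ : ∃ g' u, (Fin.snoc (α := fun _ => ℤˣ) g' u : Hypercube (d + 1)) = g :=
      ⟨_, _, Fin.snoc_init_self g⟩
    have hmul : ∀ (x : Hypercube d) (v : ℤˣ), (Fin.snoc (α := fun _ => ℤˣ) x v : Hypercube (d + 1)) *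
        (Fin.snoc (α := fun _ => ℤˣ) g u : Hypercube (d + 1)) =
        (Fin.snoc (α := fun _ => ℤˣ) (x * g) (v * u) : Hypercube (d + 1)) := by
      intro x v
      ext i
      refine Fin.lastCases ?_ (fun i => ?_) i <;> simp
    have hle := negCount_le g
    rw [expect_snoc]
    simp_rw [hmul, negCount_snoc, expect_units_int]
    rcases Int.units_eq_one_or u with rfl | rfl
    · have := ih g (avgSame f)
      simp_rw [avgSame_apply] at this
      have e : d + 1 - negCount g = d - negCount g + 1 := by omega
      have h1 : (1 : ℤˣ) ≠ -1 := by decide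
      simp only [h1, if_false, add_zero, mul_one, if_true, ← add_assoc, e]
      rw [this, pow_succ, mul_assoc, (commute_avg.pow_right _).eq, ← mul_assoc,
        Module.End.mul_apply _ avgSame]
    · have := ih g (avgFlip f)
      simp_rw [avgFlip_apply] at this
      have e : d + 1 - (negCount g + 1) = d - negCount g := by omega
      have h1 : (1 : ℤˣ) ≠ -1 := by decide
      simp only [h1, if_false, add_zero, one_mul, if_true, ← add_assoc, e, neg_mul_neg]
      rw [pow_succ, ← mul_assoc, Module.End.mul_apply _ avgFlip, ← this]
      refine Finset.expect_congr rfl fun x _ => ?_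
      ring

/-- `P[|x| = t, |x g| = t]` for `x` uniform on `{±1}^N` and `g` with `m` negative coordinates, where
`|x|` is the number of negative coordinates of `x`. -/
noncomputable def slicePair (N t m : ℕ) : ℝ :=
  (avgSame ^ (N - m) * avgFlip ^ m) (fun c => if c.1 = t ∧ c.2 = t then 1 else 0) (0, 0)

/-- `P[|x| ≤ t, |x g| ≤ t]` for `x` uniform on `{±1}^d` and `g` with `m` negative coordinates, where
`|x|` is the number of negative coordinates of `x`. -/
noncomputable def ballPair (d t m : ℕ) : ℝ :=
  (avgSame ^ (d - m) * avgFlip ^ m) (fun c => if c.1 ≤ t ∧ c.2 ≤ t then 1 else 0) (0, 0)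

theorem expect_slice {N : ℕ} (t : ℕ) (g : Hypercube N) :
    𝔼 x : Hypercube N, (if negCount x = t ∧ negCount (x * g) = t then (1 : ℝ) else 0) =
      slicePair N t (negCount g) := by
  have := expect_pair g (fun c => if c.1 = t ∧ c.2 = t then 1 else 0) 0 0
  simpa [slicePair] using this

theorem expect_ball {d : ℕ} (t : ℕ) (g : Hypercube d) :
    𝔼 x : Hypercube d, (if negCount x ≤ t ∧ negCount (x * g) ≤ t then (1 : ℝ) else 0) =
      ballPair d t (negCount g) := by
  have := expect_pair g (fun c => if c.1 ≤ t ∧ c.2 ≤ t then 1 else 0) 0 0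
  simpa [ballPair] using this

/-- With T₁, T₂ the shifts, `avgSame - avgFlip` is (T₁ − 1)(T₂ − 1)/2, and each difference turns the
indicator of counts ≤ t into minus that of counts = t. -/
theorem ballPair_sub_succ {d t m : ℕ} (hm : m < d) :
    ballPair d t m - ballPair d t (m + 1) = slicePair (d - 1) t m / 2 := by
  set f : ℕ × ℕ → ℝ := fun c => if c.1 ≤ t ∧ c.2 ≤ t then 1 else 0 with hf
  have key : avgSame f - avgFlip f =
      (1 / 2 : ℝ) • fun c : ℕ × ℕ => if c.1 = t ∧ c.2 = t then (1 : ℝ) else 0 := by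
    ext ⟨a, b⟩
    simp only [Pi.sub_apply, Pi.smul_apply, avgSame_apply, avgFlip_apply, hf, smul_eq_mul]
    split_ifs <;> first | omega | norm_num
  obtain ⟨r, rfl⟩ : ∃ r, d = m + 1 + r := ⟨d - (m + 1), by omega⟩
  have e1 : ballPair (m + 1 + r) t m = (avgSame ^ r * avgFlip ^ m) (avgSame f) (0, 0) := by
    unfold ballPair
    rw [← hf, show m + 1 + r - m = r + 1 by omega, pow_succ, mul_assoc, (commute_avg.pow_right _).eq,
      ← mul_assoc, Module.End.mul_apply _ avgSame]
  have e2 : ballPair (m + 1 + r) t (m + 1) = (avgSame ^ r * avgFlip ^ m) (avgFlip f) (0, 0) := by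
    unfold ballPair
    rw [← hf, show m + 1 + r - (m + 1) = r by omega, pow_succ, ← mul_assoc,
      Module.End.mul_apply _ avgFlip]
  rw [e1, e2, ← Pi.sub_apply, ← map_sub, key, map_smul, Pi.smul_apply, slicePair, smul_eq_mul,
    show m + 1 + r - 1 - m = r by omega]
  ring

/-- For x and xg to have the same count, exactly j of the 2j flipped coordinates of x must be
negative; the other t − j negatives lie among the rest. -/
theorem slicePair_two_mul {N t j : ℕ} (hj : j ≤ t) (hN : 2 * j ≤ N) :
    slicePair N t (2 * j) = (2 * j).choose j * (N - 2 * j).choose (t - j) / 2 ^ N := by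
  rw [slicePair, (commute_avg.pow_pow _ _).eq, Module.End.mul_apply, avgFlip_pow_apply]
  simp_rw [avgSame_pow_apply, zero_add]
  rw [Finset.sum_eq_single j]
  · rw [Finset.sum_eq_single (t - j)]
    · rw [if_pos (by constructor <;> omega)]
      obtain ⟨r, rfl⟩ := Nat.exists_eq_add_of_le hN
      rw [show 2 * j + r - 2 * j = r by omega, pow_add 2 (2 * j) r]
      simp only [one_div, inv_pow]
      field_simp
    · intro i _ hi
      rw [if_neg (by omega), mul_zero]
    · intro h
      rw [Nat.choose_eq_zero_of_lt (by rw [Finset.mem_range] at h; omega)]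
      simp
  · intro i hi hij
    rw [Finset.sum_eq_zero, mul_zero, mul_zero]
    intro i' _
    rw [Finset.mem_range] at hi
    rw [if_neg (by omega), mul_zero]
  · intro h
    simp at h
    omega

theorem slicePair_nonneg (N t m : ℕ) : 0 ≤ slicePair N t m := by
  rw [slicePair, (commute_avg.pow_pow _ _).eq, Module.End.mul_apply, avgFlip_pow_apply]
  simp_rw [avgSame_pow_apply]
  refine mul_nonneg (by positivity) (Finset.sum_nonneg fun _ _ => mul_nonneg (by positivity)
    (mul_nonneg (by positivity) (Finset.sum_nonneg fun _ _ => mul_nonneg (by positivity) ?_)))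
  split_ifs <;> norm_num

/-- Flipping an odd number of signs changes the parity of the negative count. -/
theorem slicePair_of_odd {N t m : ℕ} (hm : Odd m) : slicePair N t m = 0 := by
  rw [slicePair, (commute_avg.pow_pow _ _).eq, Module.End.mul_apply, avgFlip_pow_apply]
  simp_rw [avgSame_pow_apply]
  obtain ⟨k, rfl⟩ := hm
  rw [Finset.sum_eq_zero, mul_zero]
  intro i hi
  rw [Finset.sum_eq_zero, mul_zero, mul_zero]
  intro i' _
  rw [Finset.mem_range] at hi
  rw [if_neg (by omega), mul_zero]

end PairOperators

/-! ### Slow variation of the slice correlations over even arguments. -/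

section SliceSmoothness

theorem choose_add_two_mul (k l : ℕ) :
    ((k + 1) + (l + 1)).choose (k + 1) * ((k + 1) * (l + 1)) =
      (k + l + 2) * (k + l + 1) * (k + l).choose k := by
  rw [Nat.choose_symm_add (a := k + 1), Nat.choose_symm_add (a := k)]
  have h1 := Nat.add_choose_mul_factorial_mul_factorial (k + 1) (l + 1)
  have h2 := Nat.add_choose_mul_factorial_mul_factorial k l
  have e : (k + 1) + (l + 1) = (k + l + 1) + 1 := by ring
  rw [Nat.factorial_succ k, Nat.factorial_succ l, e, Nat.factorial_succ (k + l + 1),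
    Nat.factorial_succ (k + l), ← h2] at h1
  rw [e]
  refine Nat.eq_of_mul_eq_mul_right (Nat.mul_pos k.factorial_pos l.factorial_pos) ?_
  linarith

/-- With r = N − 2j and b = N − 2t, the ratio of consecutive even terms is (2j + 1)/(2j + 2) · (r² −
b²)/(r(r − 1)), close to 1 when j and r are of order N and b is small against N. -/
theorem slicePair_recurrence {N t j : ℕ} (h1 : j + 1 ≤ t) (h2 : j + 1 + t ≤ N) :
    slicePair N t (2 * (j + 1)) * ((j + 1) * ((N - 2 * j) * (N - 2 * j - 1))) =
      slicePair N t (2 * j) * (2 * (2 * j + 1) * ((t - j) * (N - t - j))) := by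
  obtain ⟨k, rfl⟩ := Nat.exists_eq_add_of_le h1
  obtain ⟨l, rfl⟩ := Nat.exists_eq_add_of_le h2
  rw [slicePair_two_mul (by omega) (by omega), slicePair_two_mul (by omega) (by omega)]
  rw [show j + 1 + (j + 1 + k) + l - 2 * (j + 1) = k + l by omega,
    show j + 1 + k - (j + 1) = k by omega,
    show j + 1 + (j + 1 + k) + l - 2 * j = (k + 1) + (l + 1) by omega,
    show j + 1 + k - j = k + 1 by omega]
  have e1 := Nat.succ_mul_centralBinom_succ j
  rw [Nat.centralBinom, Nat.centralBinom] at e1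
  have e2 := choose_add_two_mul k l
  have e1' : ((j : ℝ) + 1) * (2 * (j + 1)).choose (j + 1) = 2 * (2 * j + 1) * (2 * j).choose j := by
    exact_mod_cast e1
  have e2' : (((k + 1) + (l + 1)).choose (k + 1) : ℝ) * ((k + 1) * (l + 1)) =
      (k + l + 2) * (k + l + 1) * (k + l).choose k := by
    exact_mod_cast e2
  rw [div_mul_eq_mul_div, div_mul_eq_mul_div]
  congr 1
  push_cast
  linear_combination (((k : ℝ) + l + 2) * (k + l + 1) * (k + l).choose k) * e1' -
    2 * (2 * j + 1) * (2 * j).choose j * e2'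

/-- Bound for the relative change of `slicePair N t` between consecutive even arguments. -/
noncomputable def sliceRate (N t : ℕ) : ℝ := 8 / N + 32 * ((N : ℝ) - 2 * t) ^ 2 / N ^ 2

theorem sliceRate_nonneg (N t : ℕ) : 0 ≤ sliceRate N t := by
  unfold sliceRate; positivity

theorem sliceRate_upper {N j r b ε : ℝ} (hN : 0 < N) (hj : 0 ≤ j) (hr : N / 8 ≤ r - 1)
    (hε : 8 / N ≤ ε) :
    2 * (2 * j + 1) * ((r ^ 2 - b ^ 2) / 4) ≤ (1 + ε) * ((j + 1) * (r * (r - 1))) := by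
  have hε0 : 0 ≤ ε := le_trans (by positivity) hε
  have h3 : r ≤ (1 + ε) * (r - 1) := by
    have : 1 ≤ ε * (r - 1) := by
      calc (1 : ℝ) = 8 / N * (N / 8) := by field_simp
        _ ≤ ε * (r - 1) := mul_le_mul hε hr (by positivity) hε0
    linarith
  have hr0 : 0 ≤ r := by linarith
  calc 2 * (2 * j + 1) * ((r ^ 2 - b ^ 2) / 4) ≤ 2 * (2 * j + 1) * (r ^ 2 / 4) := by
        refine mul_le_mul_of_nonneg_left ?_ (by linarith)
        linarith [sq_nonneg b]
    _ ≤ (j + 1) * r * r := by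
        have e : (j + 1) * r * r = 2 * (2 * j + 1) * (r ^ 2 / 4) + r ^ 2 / 2 := by ring
        linarith [sq_nonneg r]
    _ ≤ (j + 1) * r * ((1 + ε) * (r - 1)) :=
        mul_le_mul_of_nonneg_left h3 (mul_nonneg (by linarith) hr0)
    _ = _ := by ring

theorem sliceRate_lower {N j r b : ℝ} (hN : 0 < N) (hj : N / 4 ≤ 2 * j) (hr : N / 4 ≤ r)
    (hb : 32 * b ^ 2 ≤ N ^ 2) :
    (j + 1) * (r * (r - 1)) ≤
      (1 + (8 / N + 32 * b ^ 2 / N ^ 2)) * (2 * (2 * j + 1) * ((r ^ 2 - b ^ 2) / 4)) := by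
  have h3 : 2 * j + 2 ≤ (1 + 4 / N) * (2 * j + 1) := by
    have : 1 ≤ 4 / N * (2 * j + 1) := by
      calc (1 : ℝ) = 4 / N * (N / 4) := by field_simp
        _ ≤ _ := mul_le_mul_of_nonneg_left (by linarith) (by positivity)
    linarith
  have hr2 : N ^ 2 / 16 ≤ r ^ 2 := by
    have := pow_le_pow_left₀ (by positivity) hr 2
    linarith
  have h5 : N ^ 2 / 32 ≤ r ^ 2 - b ^ 2 := by linarith
  have hβ : 0 ≤ 32 * b ^ 2 / N ^ 2 := by positivity
  have h4 : r ^ 2 ≤ (1 + 32 * b ^ 2 / N ^ 2) * (r ^ 2 - b ^ 2) := by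
    have : b ^ 2 ≤ 32 * b ^ 2 / N ^ 2 * (r ^ 2 - b ^ 2) := by
      calc b ^ 2 = 32 * b ^ 2 / N ^ 2 * (N ^ 2 / 32) := by field_simp
        _ ≤ _ := mul_le_mul_of_nonneg_left h5 hβ
    linarith
  have h6 : (1 + 4 / N) * (1 + 32 * b ^ 2 / N ^ 2) ≤ 1 + (8 / N + 32 * b ^ 2 / N ^ 2) := by
    have h7 : 32 * b ^ 2 / N ^ 2 ≤ 1 := by
      rw [div_le_one (by positivity)]; exact hb
    have h8 : 0 ≤ 4 / N := by positivity
    have h9 := mul_le_mul_of_nonneg_left h7 h8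
    have h10 : 8 / N = 4 / N + 4 / N := by ring
    rw [h10]
    linarith
  have hjr : 0 ≤ (j + 1) * r := mul_nonneg (by linarith) (by linarith)
  have h11 : 0 ≤ (2 * (2 * j + 1) * ((r ^ 2 - b ^ 2) / 4)) :=
    mul_nonneg (by linarith) (by linarith [sq_nonneg N])
  calc (j + 1) * (r * (r - 1)) ≤ (2 * j + 2) * r ^ 2 / 2 := by
        have e : (2 * j + 2) * r ^ 2 / 2 = (j + 1) * (r * (r - 1)) + (j + 1) * r := by ring
        linarith
    _ ≤ ((1 + 4 / N) * (2 * j + 1)) * ((1 + 32 * b ^ 2 / N ^ 2) * (r ^ 2 - b ^ 2)) / 2 := by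
        have := mul_le_mul h3 h4 (sq_nonneg r)
          (mul_nonneg (by positivity) (by linarith : (0 : ℝ) ≤ 2 * j + 1))
        linarith
    _ = ((1 + 4 / N) * (1 + 32 * b ^ 2 / N ^ 2)) * (2 * (2 * j + 1) * ((r ^ 2 - b ^ 2) / 4)) := by
        ring
    _ ≤ _ := mul_le_mul_of_nonneg_right h6 h11

theorem slicePair_step {N t j : ℕ} (hN : 8 ≤ N) (hb : 32 * ((N : ℝ) - 2 * t) ^ 2 ≤ N ^ 2)
    (h1 : (N : ℝ) / 4 ≤ 2 * j) (h2 : 2 * (j + 1 : ℝ) ≤ 3 * N / 4) :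
    slicePair N t (2 * (j + 1)) ≤ (1 + sliceRate N t) * slicePair N t (2 * j) ∧
      slicePair N t (2 * j) ≤ (1 + sliceRate N t) * slicePair N t (2 * (j + 1)) := by
  have hN' : (8 : ℝ) ≤ N := by exact_mod_cast hN
  have hb' : |(N : ℝ) - 2 * t| < N / 4 := by
    refine abs_lt_of_sq_lt_sq ?_ (by positivity)
    nlinarith
  obtain ⟨hb1, hb2⟩ := abs_lt.1 hb'
  have hjt : j + 1 ≤ t := by
    have : (j : ℝ) < t := by linarith
    exact_mod_cast this
  have hjN : j + 1 + t ≤ N := by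
    have : (j : ℝ) + t < N := by linarith
    have : j + t < N := by exact_mod_cast this
    omega
  have hrec := slicePair_recurrence hjt hjN
  have hx : 0 ≤ slicePair N t (2 * (j + 1)) := slicePair_nonneg _ _ _
  have hy : 0 ≤ slicePair N t (2 * j) := slicePair_nonneg _ _ _
  have hkk : ((t : ℝ) - j) * (N - t - j) =
      (((N : ℝ) - 2 * j) ^ 2 - ((N : ℝ) - 2 * t) ^ 2) / 4 := by ring
  rw [hkk] at hrec
  have hup := sliceRate_upper (N := N) (j := j) (r := N - 2 * j) (b := (N : ℝ) - 2 * t)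
    (ε := sliceRate N t) (by linarith) (by positivity) (by linarith)
    (le_add_of_nonneg_right (by positivity))
  have hlo := sliceRate_lower (N := N) (j := j) (r := N - 2 * j) (b := (N : ℝ) - 2 * t)
    (by linarith) h1 (by linarith) hb
  change _ ≤ (1 + sliceRate N t) * _ at hlo
  have hA : 0 < ((j : ℝ) + 1) * (((N : ℝ) - 2 * j) * ((N : ℝ) - 2 * j - 1)) :=
    mul_pos (by positivity) (mul_pos (by linarith) (by linarith))
  generalize ((j : ℝ) + 1) * (((N : ℝ) - 2 * j) * ((N : ℝ) - 2 * j - 1)) = A at *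
  generalize 2 * (2 * (j : ℝ) + 1) * ((((N : ℝ) - 2 * j) ^ 2 - ((N : ℝ) - 2 * t) ^ 2) / 4) = B at *
  have hε := sliceRate_nonneg N t
  have hB : 0 < B := by
    by_contra! h
    exact absurd (hA.trans_le hlo) (not_lt.2 (mul_nonpos_of_nonneg_of_nonpos (by linarith) h))
  constructor
  · refine le_of_mul_le_mul_right ?_ hA
    rw [hrec, mul_comm (1 + _) (slicePair N t (2 * j)), mul_assoc (slicePair N t (2 * j))]
    exact mul_le_mul_of_nonneg_left hup hy
  · refine le_of_mul_le_mul_right ?_ hB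
    rw [← hrec, mul_comm (1 + _) (slicePair N t (2 * (j + 1))),
      mul_assoc (slicePair N t (2 * (j + 1)))]
    exact mul_le_mul_of_nonneg_left hlo hx

theorem le_exp_mul_of_step {f : ℕ → ℝ} (hf : ∀ n, 0 ≤ f n) {ε : ℝ} (j n : ℕ)
    (hstep : ∀ i, j ≤ i → i < j + n → f (i + 1) ≤ (1 + ε) * f i ∧ f i ≤ (1 + ε) * f (i + 1)) :
    f (j + n) ≤ Real.exp (ε * n) * f j ∧ f j ≤ Real.exp (ε * n) * f (j + n) := by
  induction n with
  | zero => simp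
  | succ n ih =>
    obtain ⟨i1, i2⟩ := ih fun i h h' => hstep i h (by omega)
    obtain ⟨s1, s2⟩ := hstep (j + n) (by omega) (by omega)
    have he : 1 + ε ≤ Real.exp ε := by linarith [Real.add_one_le_exp ε]
    have e : Real.exp (ε * (n + 1 : ℕ)) = Real.exp ε * Real.exp (ε * n) := by
      rw [← Real.exp_add]; push_cast; ring_nf
    have hE : 0 < Real.exp (ε * n) := Real.exp_pos _
    have hE' : 0 < Real.exp ε := Real.exp_pos _
    rw [e, ← add_assoc]
    have h0 := hf (j + n)
    have h1 := hf (j + n + 1)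
    constructor
    · calc f (j + n + 1) ≤ (1 + ε) * f (j + n) := s1
        _ ≤ Real.exp ε * f (j + n) := mul_le_mul_of_nonneg_right he h0
        _ ≤ Real.exp ε * (Real.exp (ε * n) * f j) := mul_le_mul_of_nonneg_left i1 hE'.le
        _ = _ := by ring
    · calc f j ≤ Real.exp (ε * n) * f (j + n) := i2
        _ ≤ Real.exp (ε * n) * (Real.exp ε * f (j + n + 1)) :=
            mul_le_mul_of_nonneg_left (s2.trans (mul_le_mul_of_nonneg_right he h1)) hE.le
        _ = _ := by ring

theorem slicePair_even_le_exp {N t j : ℕ} (hN : 8 ≤ N) (hb : 32 * ((N : ℝ) - 2 * t) ^ 2 ≤ N ^ 2)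
    (h1 : (N : ℝ) / 4 ≤ 2 * j) (n : ℕ) (h2 : 2 * (j + n : ℝ) ≤ 3 * N / 4) :
    slicePair N t (2 * (j + n)) ≤ Real.exp (sliceRate N t * n) * slicePair N t (2 * j) ∧
      slicePair N t (2 * j) ≤ Real.exp (sliceRate N t * n) * slicePair N t (2 * (j + n)) := by
  refine le_exp_mul_of_step (f := fun i => slicePair N t (2 * i)) (fun _ => slicePair_nonneg _ _ _)
    j n fun i hi hi' => slicePair_step hN hb ?_ ?_
  · have : (j : ℝ) ≤ i := by exact_mod_cast hi
    linarith
  · have : (i : ℝ) + 1 ≤ j + n := by exact_mod_cast hi'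
    linarith

/-- The rate is per step of size 2 in m, hence the division by 4: |m − m'|/2 is at most a quarter of
the sum of the deviations |N − 2m| and |N − 2m'|. -/
theorem slicePair_le_exp {N t m m' : ℕ} (hN : 8 ≤ N) (hb : 32 * ((N : ℝ) - 2 * t) ^ 2 ≤ N ^ 2)
    (hm : Even m) (hm' : Even m') (h : |(N : ℝ) - 2 * m| ≤ N / 2) (h' : |(N : ℝ) - 2 * m'| ≤ N / 2) :
    slicePair N t m ≤ Real.exp (sliceRate N t * ((|(N : ℝ) - 2 * m| + |(N : ℝ) - 2 * m'|) / 4)) *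
      slicePair N t m' := by
  obtain ⟨j, rfl⟩ := hm
  obtain ⟨j', rfl⟩ := hm'
  rw [← two_mul, ← two_mul] at *
  push_cast at *
  have hε := sliceRate_nonneg N t
  obtain ⟨a1, a2⟩ := abs_le.1 h
  obtain ⟨a3, a4⟩ := abs_le.1 h'
  rcases le_total j j' with hj | hj
  · obtain ⟨n, rfl⟩ := Nat.exists_eq_add_of_le hj
    push_cast at *
    refine (slicePair_even_le_exp hN hb (by linarith) n (by linarith)).2.trans ?_
    gcongr
    · exact slicePair_nonneg _ _ _
    · linarith [le_abs_self ((N : ℝ) - 2 * (2 * j)), neg_le_abs ((N : ℝ) - 2 * (2 * (j + n)))]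
  · obtain ⟨n, rfl⟩ := Nat.exists_eq_add_of_le hj
    push_cast at *
    refine (slicePair_even_le_exp hN hb (by linarith) n (by linarith)).1.trans ?_
    gcongr
    · exact slicePair_nonneg _ _ _
    · linarith [le_abs_self ((N : ℝ) - 2 * (2 * j')), neg_le_abs ((N : ℝ) - 2 * (2 * (j' + n)))]

/-- `P[|x| = t]` for `x` uniform on `{±1}^N`. -/
noncomputable def sliceProb (N t : ℕ) : ℝ :=
  𝔼 x : Hypercube N, if negCount x = t then (1 : ℝ) else 0

theorem sliceProb_nonneg (N t : ℕ) : 0 ≤ sliceProb N t :=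
  Finset.expect_nonneg fun _ _ => by positivity

theorem expect_slicePair (N t : ℕ) :
    𝔼 g : Hypercube N, slicePair N t (negCount g) = sliceProb N t ^ 2 := by
  simp_rw [← expect_slice]
  rw [Finset.expect_comm]
  have : ∀ x : Hypercube N,
      𝔼 g : Hypercube N, (if negCount x = t ∧ negCount (x * g) = t then (1 : ℝ) else 0) =
        (if negCount x = t then (1 : ℝ) else 0) * sliceProb N t := by
    intro x
    have e : sliceProb N t = 𝔼 g : Hypercube N, if negCount (x * g) = t then (1 : ℝ) else 0 :=
      (Fintype.expect_equiv (Equiv.mulLeft x) _ _ fun _ => rfl).symm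
    rw [e, Finset.mul_expect]
    refine Finset.expect_congr rfl fun g _ => ?_
    by_cases hx : negCount x = t <;> simp [hx]
  simp_rw [this]
  rw [← Finset.expect_mul, sq]
  rfl

/-- A slowly varying function is bounded by its average. Even g within 3√N of balance carry mass at
least 1/4, which gives the factor 4; N ≥ 144 puts them in the range where the ratio estimates hold.
-/
theorem slicePair_le {N t m : ℕ} (hN : 144 ≤ N) (hb : 32 * ((N : ℝ) - 2 * t) ^ 2 ≤ N ^ 2)
    (hm : |(N : ℝ) - 2 * m| ≤ N / 2) :
    slicePair N t m ≤ 4 * sliceProb N t ^ 2 *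
      Real.exp (sliceRate N t * ((|(N : ℝ) - 2 * m| + 3 * √N) / 4)) := by
  classical
  rcases Nat.even_or_odd m with he | ho
  swap
  · rw [slicePair_of_odd ho]; positivity
  set E := Real.exp (sliceRate N t * ((|(N : ℝ) - 2 * m| + 3 * √N) / 4)) with hE
  have hN' : (144 : ℝ) ≤ N := by exact_mod_cast hN
  have hsq : √(N : ℝ) ^ 2 = N := Real.sq_sqrt (by positivity)
  have hsqrt : 3 * √(N : ℝ) ≤ N / 4 := by
    have : 12 ≤ √(N : ℝ) := Real.le_sqrt_of_sq_le (by linarith)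
    nlinarith
  have hs := slicePair_nonneg N t m
  have hpt : ∀ g : Hypercube N, ((if Even (negCount g) then (1 : ℝ) else 0) -
      (if 3 * √(N : ℝ) ≤ |coordSum g| then (1 : ℝ) else 0)) * slicePair N t m ≤
      E * slicePair N t (negCount g) := by
    intro g
    have hg0 : 0 ≤ E * slicePair N t (negCount g) :=
      mul_nonneg (Real.exp_pos _).le (slicePair_nonneg _ _ _)
    by_cases h1 : Even (negCount g)
    · by_cases h2 : 3 * √(N : ℝ) ≤ |coordSum g|
      · simpa [h1, h2] using hg0
      · simp only [h1, h2, if_true, if_false, sub_zero, one_mul]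
        rw [coordSum_eq, not_le] at h2
        refine (slicePair_le_exp (by omega) hb he h1 hm (by linarith)).trans ?_
        have hε := sliceRate_nonneg N t
        rw [hE]
        gcongr
        exact slicePair_nonneg _ _ _
    · simp only [h1, if_false, zero_sub]
      refine le_trans (mul_nonpos_of_nonpos_of_nonneg ?_ hs) hg0
      split_ifs <;> norm_num
  have hav := Finset.expect_le_expect (s := Finset.univ) fun g _ => hpt g
  rw [← Finset.expect_mul, ← Finset.mul_expect, expect_slicePair, Finset.expect_sub_distrib,
    expect_even_negCount (by omega)] at hav
  have htail := expect_le_abs_coordSum (d := N) (by omega) (R := 3 * √(N : ℝ)) (by positivity)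
  -- The two-sided tail is thus at most 2 · 1/8, leaving 1/2 − 1/4 = 1/4 for the even central
  -- points.
  have hexp : Real.exp (-((3 * √(N : ℝ)) ^ 2 / (2 * N))) ≤ 1 / 8 := by
    have e : (3 * √(N : ℝ)) ^ 2 / (2 * N) = 9 / 2 := by
      rw [mul_pow, hsq]; field_simp; norm_num
    rw [e, Real.exp_neg, one_div]
    refine inv_anti₀ (by norm_num) ?_
    have := Real.quadratic_le_exp_of_nonneg (show (0 : ℝ) ≤ 9 / 2 by norm_num)
    linarith
  have : (1 / 4 : ℝ) * slicePair N t m ≤ E * sliceProb N t ^ 2 :=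
    le_trans (mul_le_mul_of_nonneg_right (by linarith) hs) hav
  linarith

end SliceSmoothness

/-! ### Threshold sets: level-one inequality, location of the threshold, variation of correlations.
-/

section ThresholdSets

/-- `P[|x| ≤ t]` for `x` uniform on `{±1}^d`. -/
noncomputable def ballProb (d t : ℕ) : ℝ :=
  𝔼 x : Hypercube d, if negCount x ≤ t then (1 : ℝ) else 0

/-- As p > 0 forces τ ≤ d, the natural floor of (d − τ)/2 is not truncated; p < 1 forces t < d. -/
theorem exists_hardThreshold_eq {d : ℕ} {p : unitInterval} {τ : ℝ} (h : IsThreshold d p τ)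
    (hp0 : 0 < (p : ℝ)) (hp1 : (p : ℝ) < 1) :
    ∃ t < d, (∀ x : Hypercube d, (hardThreshold d τ x : ℝ) = if negCount x ≤ t then 1 else 0) ∧
      ballProb d t = p := by
  classical
  unfold IsThreshold at h
  have h2d : (0 : ℝ) < 2 ^ d := by positivity
  have hτ : τ ≤ d := by
    by_contra! hlt
    have : (Finset.univ.filter fun x : Hypercube d => τ ≤ coordSum x) = ∅ := by
      refine Finset.filter_eq_empty_iff.2 fun x _ => ?_
      rw [coordSum_eq, not_le]
      have : (0 : ℝ) ≤ negCount x := by positivity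
      linarith
    rw [this] at h
    simp at h
    linarith
  have hiff : ∀ x : Hypercube d, τ ≤ coordSum x ↔ negCount x ≤ ⌊((d : ℝ) - τ) / 2⌋₊ := by
    intro x
    rw [Nat.le_floor_iff (by linarith), coordSum_eq]
    constructor <;> intro h <;> linarith
  have hball : ballProb d ⌊((d : ℝ) - τ) / 2⌋₊ = p := by
    unfold ballProb
    simp_rw [← hiff]
    rw [Fintype.expect_eq_sum_div_card, Finset.sum_boole, ← h]
    simp
  refine ⟨⌊((d : ℝ) - τ) / 2⌋₊, ?_, fun x => ?_, hball⟩
  · by_contra! hle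
    have : ballProb d ⌊((d : ℝ) - τ) / 2⌋₊ = 1 := by
      unfold ballProb
      simp_rw [fun x : Hypercube d => if_pos (c := negCount x ≤ ⌊((d : ℝ) - τ) / 2⌋₊)
        (t := (1 : ℝ)) (e := 0) ((negCount_le x).trans hle)]
      simp
    linarith
  · unfold hardThreshold
    simp only [hiff]
    split_ifs <;> simp

theorem expect_insertNth {α : Type*} [Fintype α] {n : ℕ} (i : Fin (n + 1))
    (F : (Fin (n + 1) → α) → ℝ) :
    𝔼 x, F x = 𝔼 x : Fin n → α, 𝔼 y, F (Fin.insertNth (α := fun _ => α) i y x) := by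
  rw [Finset.expect_comm, ← Finset.expect_product', Finset.univ_product_univ]
  exact (Fintype.expect_equiv (Fin.insertNthEquiv (fun _ => α) i) _ _ fun _ => rfl).symm

theorem negCount_insertNth {d : ℕ} (i : Fin (d + 1)) (x : Hypercube d) (u : ℤˣ) :
    negCount (Fin.insertNth (α := fun _ => ℤˣ) i u x : Hypercube (d + 1)) =
      negCount x + if u = -1 then 1 else 0 := by
  simp only [negCount, Finset.card_filter, Fin.sum_univ_succAbove _ i, Fin.insertNth_apply_same,
    Fin.insertNth_apply_succAbove]
  ring

/-- A coordinate contributes only when it is pivotal: the other N coordinates must contain exactly t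
negatives. -/
theorem expect_ball_mul_coordSum (N t : ℕ) :
    𝔼 x : Hypercube (N + 1), (if negCount x ≤ t then (1 : ℝ) else 0) * coordSum x =
      (N + 1) * sliceProb N t / 2 := by
  simp_rw [coordSum, Finset.mul_sum]
  rw [Finset.expect_sum_comm]
  have : ∀ i : Fin (N + 1), 𝔼 x : Hypercube (N + 1),
      (if negCount x ≤ t then (1 : ℝ) else 0) * ((x i : ℤ) : ℝ) = sliceProb N t / 2 := by
    intro i
    rw [expect_insertNth i, sliceProb, Finset.expect_div]
    refine Finset.expect_congr rfl fun x _ => ?_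
    rw [expect_units_int]
    simp only [negCount_insertNth, Fin.insertNth_apply_same]
    have h1 : (1 : ℤˣ) ≠ -1 := by decide
    simp only [h1, if_false, if_true, add_zero]
    split_ifs <;> first | omega | simp
  simp_rw [this]
  rw [Finset.sum_const, Finset.card_univ, Fintype.card_fin, nsmul_eq_mul, mul_div_assoc,
    Nat.cast_succ]

/-- A set of density `p` has mean coordinate sum at most `√(2 d (1 + log (1 / p)))`. -/
theorem sliceProb_sq_le {N t : ℕ} {p : ℝ} (hp : ballProb (N + 1) t = p) (hp0 : 0 < p)
    (hp1 : p < 1) :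
    sliceProb N t ^ 2 * (N + 1 : ℕ) ≤ 8 * p ^ 2 * (1 - Real.log p) := by
  set L := 1 - Real.log p with hL
  have hL1 : 1 ≤ L := by linarith [Real.log_nonpos hp0.le hp1.le]
  set D : ℝ := ((N + 1 : ℕ) : ℝ) with hD
  have hD0 : 0 < D := by rw [hD]; positivity
  -- Entropy duality: use y ≤ a + e^{y − a} with y = r · `coordSum x` on the set. The choice of a
  -- makes the mean of the exponential at most p.
  have hG : ∀ r : ℝ, r * (D * sliceProb N t / 2) ≤ p * (r ^ 2 * D / 2 + L) := by
    intro r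
    set a : ℝ := r ^ 2 * D / 2 + L - 1 with ha
    have hexp := expect_exp_coordSum_le (N + 1) r
    have hb : p = 𝔼 x : Hypercube (N + 1), if negCount x ≤ t then (1 : ℝ) else 0 := hp.symm
    have e := expect_ball_mul_coordSum N t
    have hD' : (N : ℝ) + 1 = D := by rw [hD]; push_cast; rfl
    rw [hD'] at e
    rw [← e, Finset.mul_expect]
    calc 𝔼 x : Hypercube (N + 1), r * ((if negCount x ≤ t then (1 : ℝ) else 0) * coordSum x)
        ≤ 𝔼 x : Hypercube (N + 1), ((if negCount x ≤ t then (1 : ℝ) else 0) * a +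
            Real.exp (-(a + 1)) * Real.exp 1 * Real.exp (r * coordSum x)) := by
          refine Finset.expect_le_expect fun x _ => ?_
          rw [← Real.exp_add, ← Real.exp_add]
          split_ifs
          · linarith [Real.add_one_le_exp (-(a + 1) + 1 + r * coordSum x)]
          · simp only [zero_mul, mul_zero, zero_add]
            positivity
      _ ≤ p * a + p := by
          rw [Finset.expect_add_distrib, ← Finset.expect_mul, ← Finset.mul_expect, ← hb]
          have h3 : Real.exp (-(a + 1)) * Real.exp 1 * Real.exp (r ^ 2 * D / 2) = p := by
            rw [← Real.exp_add, ← Real.exp_add, ha, hL]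
            have : -(r ^ 2 * D / 2 + (1 - Real.log p) - 1 + 1) + 1 + r ^ 2 * D / 2 = Real.log p := by
              ring
            rw [this, Real.exp_log hp0]
          have h4 : Real.exp (-(a + 1)) * Real.exp 1 *
              (𝔼 x : Hypercube (N + 1), Real.exp (r * coordSum x)) ≤
              Real.exp (-(a + 1)) * Real.exp 1 * Real.exp (r ^ 2 * D / 2) := by gcongr
          linarith
      _ = _ := by rw [ha]; ring
  -- This r balances the two terms r²D/2 and L.
  have hr := hG (√(2 * L / D))
  have hsq : √(2 * L / D) ^ 2 = 2 * L / D := Real.sq_sqrt (by positivity)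
  set r := √(2 * L / D)
  have hr0 : 0 ≤ r := Real.sqrt_nonneg _
  have hs := sliceProb_nonneg N t
  have h1 : r * (D * sliceProb N t / 2) ≤ 2 * p * L := by
    rw [hsq] at hr
    have : 2 * L / D * D / 2 = L := by field_simp
    rw [this] at hr
    linarith
  have h2 : (r * (D * sliceProb N t / 2)) ^ 2 ≤ (2 * p * L) ^ 2 :=
    pow_le_pow_left₀ (by positivity) h1 2
  have h3 : (r * (D * sliceProb N t / 2)) ^ 2 = L / 2 * (sliceProb N t ^ 2 * D) := by
    rw [mul_pow, hsq]; field_simp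
  rw [h3] at h2
  have hL0 : 0 < L / 2 := by linarith
  refine le_of_mul_le_mul_left (h2.trans (le_of_eq ?_)) hL0
  ring

/-- Hoeffding applied to the set when t is below the middle, and otherwise to its complement, of
mass at least 1 − c. The centre is d − 1 because the boundary slice lives in dimension N = d − 1. -/
theorem sq_threshold_le {d t : ℕ} {p c : ℝ} (hd : 0 < d) (hp : ballProb d t = p) (hp0 : 0 < p)
    (hpc : p ≤ c) (hc : c < 1) :
    ((d : ℝ) - 1 - 2 * t) ^ 2 ≤ 2 * (1 - Real.log (1 - c)) * d * (1 - Real.log p) := by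
  classical
  have hd' : (0 : ℝ) < d := by exact_mod_cast hd
  have hL : 0 ≤ -Real.log p := by linarith [Real.log_nonpos hp0.le (by linarith)]
  have hC : 0 ≤ -Real.log (1 - c) := by
    linarith [Real.log_nonpos (show 0 ≤ 1 - c by linarith) (by linarith)]
  rcases le_or_gt 0 ((d : ℝ) - 1 - 2 * t) with hb | hb
  · have h := expect_le_mul_coordSum hd (R := (d : ℝ) - 2 * t) (by linarith) (ε := 1) (by norm_num)
    have e : 𝔼 x : Hypercube d, (if (d : ℝ) - 2 * t ≤ 1 * coordSum x then (1 : ℝ) else 0) = p := by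
      rw [← hp]
      refine Finset.expect_congr rfl fun x _ => if_congr ?_ rfl rfl
      rw [coordSum_eq, ← Nat.cast_le (α := ℝ)]
      constructor <;> intro h <;> linarith
    rw [e] at h
    have h2 := Real.log_le_log hp0 h
    rw [Real.log_exp] at h2
    have h3 : ((d : ℝ) - 2 * t) ^ 2 ≤ -Real.log p * (2 * d) := by
      rw [← div_le_iff₀ (by positivity)]; linarith
    calc ((d : ℝ) - 1 - 2 * t) ^ 2 ≤ ((d : ℝ) - 2 * t) ^ 2 :=
          pow_le_pow_left₀ hb (by linarith) 2
      _ ≤ _ := h3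
      _ ≤ _ := by
        have : 0 ≤ d * (-Real.log p) := by positivity
        have : 0 ≤ (-Real.log (1 - c)) * d * (1 - Real.log p) := by
          refine mul_nonneg (by positivity) (by linarith)
        linarith
  · have h := expect_le_mul_coordSum hd (R := 2 * t + 2 - (d : ℝ)) (by linarith) (ε := -1)
      (by norm_num)
    have e : 𝔼 x : Hypercube d, (if 2 * t + 2 - (d : ℝ) ≤ -1 * coordSum x then (1 : ℝ) else 0) =
        1 - p := by
      have h1 : 1 - p = 𝔼 x : Hypercube d, (1 - if negCount x ≤ t then (1 : ℝ) else 0) := by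
        rw [Finset.expect_sub_distrib, Fintype.expect_const, ← hp, ballProb]
      rw [h1]
      refine Finset.expect_congr rfl fun x _ => ?_
      have : 2 * t + 2 - (d : ℝ) ≤ -1 * coordSum x ↔ ¬ negCount x ≤ t := by
        rw [coordSum_eq, not_le, ← Nat.succ_le_iff, ← Nat.cast_le (α := ℝ)]
        push_cast
        constructor <;> intro h <;> linarith
      by_cases h : negCount x ≤ t
      · rw [if_neg fun h' => this.1 h' h, if_pos h, sub_self]
      · rw [if_pos (this.2 h), if_neg h, sub_zero]
    rw [e] at h
    have h2 := Real.log_le_log (by linarith : 0 < 1 - c) ((by linarith : 1 - c ≤ 1 - p).trans h)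
    rw [Real.log_exp] at h2
    have h3 : (2 * t + 2 - (d : ℝ)) ^ 2 ≤ -Real.log (1 - c) * (2 * d) := by
      rw [← div_le_iff₀ (by positivity)]; linarith
    calc ((d : ℝ) - 1 - 2 * t) ^ 2 = (2 * t + 1 - (d : ℝ)) ^ 2 := by ring
      _ ≤ (2 * t + 2 - (d : ℝ)) ^ 2 := pow_le_pow_left₀ (by linarith) (by linarith) 2
      _ ≤ _ := h3
      _ ≤ 2 * (1 - Real.log (1 - c)) * d * 1 := by linarith
      _ ≤ _ := by
        refine mul_le_mul_of_nonneg_left (by linarith) ?_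
        exact mul_nonneg (by linarith) hd'.le

theorem expect_ballPair (d t : ℕ) :
    𝔼 g : Hypercube d, ballPair d t (negCount g) = ballProb d t ^ 2 := by
  simp_rw [← expect_ball]
  rw [Finset.expect_comm]
  have : ∀ x : Hypercube d,
      𝔼 g : Hypercube d, (if negCount x ≤ t ∧ negCount (x * g) ≤ t then (1 : ℝ) else 0) =
        (if negCount x ≤ t then (1 : ℝ) else 0) * ballProb d t := by
    intro x
    have e : ballProb d t = 𝔼 g : Hypercube d, if negCount (x * g) ≤ t then (1 : ℝ) else 0 :=
      (Fintype.expect_equiv (Equiv.mulLeft x) _ _ fun _ => rfl).symm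
    rw [e, Finset.mul_expect]
    refine Finset.expect_congr rfl fun g _ => ?_
    by_cases hx : negCount x ≤ t <;> simp [hx]
  simp_rw [this]
  rw [← Finset.expect_mul, sq]
  rfl

theorem ballPair_nonneg {d : ℕ} (t : ℕ) (g : Hypercube d) : 0 ≤ ballPair d t (negCount g) := by
  rw [← expect_ball]
  exact Finset.expect_nonneg fun x _ => by positivity

theorem ballPair_le {d : ℕ} (t : ℕ) (g : Hypercube d) :
    ballPair d t (negCount g) ≤ ballProb d t := by
  rw [← expect_ball]
  refine Finset.expect_le_expect fun x _ => ?_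
  split_ifs <;> first | omega | norm_num

theorem le_ballPair {d : ℕ} (t : ℕ) (g : Hypercube d) :
    2 * ballProb d t - 1 ≤ ballPair d t (negCount g) := by
  have e : ballProb d t = 𝔼 x : Hypercube d, if negCount (x * g) ≤ t then (1 : ℝ) else 0 :=
    (Fintype.expect_equiv (Equiv.mulRight g) _ _ fun _ => rfl).symm
  rw [two_mul]
  nth_rewrite 2 [e]
  rw [← expect_ball, ballProb, ← Finset.expect_add_distrib,
    ← Fintype.expect_const (ι := Hypercube d) (1 : ℝ), ← Finset.expect_sub_distrib]
  refine Finset.expect_le_expect fun x _ => ?_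
  split_ifs <;> first | omega | norm_num

theorem abs_ballPair_sub_le_mul {d t m n : ℕ} {B : ℝ} (h : m + n ≤ d)
    (hB : ∀ i, m ≤ i → i < m + n → slicePair (d - 1) t i ≤ B) :
    |ballPair d t m - ballPair d t (m + n)| ≤ n * (B / 2) := by
  induction n with
  | zero => simp
  | succ n ih =>
    have h1 := ih (by omega) fun i hi hi' => hB i hi (by omega)
    have h2 := ballPair_sub_succ (d := d) (t := t) (m := m + n) (by omega)
    have h3 := hB (m + n) (by omega) (by omega)
    have h4 := slicePair_nonneg (d - 1) t (m + n)
    rw [← add_assoc]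
    have e : ballPair d t m - ballPair d t (m + n + 1) =
        (ballPair d t m - ballPair d t (m + n)) + slicePair (d - 1) t (m + n) / 2 := by linarith
    rw [e]
    refine (abs_add_le _ _).trans ?_
    rw [abs_of_nonneg (div_nonneg h4 zero_le_two)]
    push_cast
    linarith

/-- Telescoping over |S − S'|/2 unit steps, S and S' being the two coordinate sums; each step costs
half a slice correlation. The `+ 1` in the exponent comes from passing to dimension d − 1. -/
theorem abs_ballPair_sub_le {N t : ℕ} (hN : 144 ≤ N) (hb : 32 * ((N : ℝ) - 2 * t) ^ 2 ≤ N ^ 2)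
    (g g' : Hypercube (N + 1)) (hg : |coordSum g| ≤ (N + 1 : ℕ) / 8)
    (hg' : |coordSum g'| ≤ (N + 1 : ℕ) / 8) :
    |ballPair (N + 1) t (negCount g) - ballPair (N + 1) t (negCount g')| ≤
      (|coordSum g| + |coordSum g'|) * sliceProb N t ^ 2 *
        Real.exp (sliceRate N t * ((|coordSum g| + |coordSum g'| + 1 + 3 * √N) / 4)) := by
  wlog hle : negCount g ≤ negCount g' generalizing g g'
  · rw [abs_sub_comm, add_comm |coordSum g|]
    exact this g' g hg' hg (le_of_not_ge hle)
  have hN' : (144 : ℝ) ≤ N := by exact_mod_cast hN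
  obtain ⟨n, hn⟩ := Nat.exists_eq_add_of_le hle
  have hS := coordSum_eq g
  have hS' := coordSum_eq g'
  set S := coordSum g
  set S' := coordSum g'
  set E := Real.exp (sliceRate N t * ((|S| + |S'| + 1 + 3 * √N) / 4)) with hE
  have hnS : (n : ℝ) = (S - S') / 2 := by
    rw [hS, hS', hn]; push_cast; ring
  push_cast at hg hg' hS hS'
  rw [hn]
  have hε := sliceRate_nonneg N t
  have key := abs_ballPair_sub_le_mul (d := N + 1) (t := t) (m := negCount g) (n := n)
    (B := 4 * sliceProb N t ^ 2 * E) (by rw [← hn]; exact negCount_le g') (by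
      intro i hi hi'
      have h1 : (negCount g : ℝ) ≤ i := by exact_mod_cast hi
      have h2 : (i : ℝ) ≤ negCount g' := by rw [hn]; exact_mod_cast hi'.le
      have h3 : |(N : ℝ) - 2 * i| ≤ |S| + |S'| + 1 := by
        rw [abs_le]
        constructor
        · linarith [neg_abs_le S', abs_nonneg S]
        · linarith [le_abs_self S, abs_nonneg S']
      refine (slicePair_le hN hb (m := i) (by linarith)).trans ?_
      rw [hE]
      gcongr)
  refine key.trans ?_
  rw [hnS]
  have h5 : S - S' ≤ |S| + |S'| := by linarith [le_abs_self S, neg_abs_le S']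
  have h6 : 0 ≤ sliceProb N t ^ 2 * E := by positivity
  calc (S - S') / 2 * (4 * sliceProb N t ^ 2 * E / 2) = (S - S') * (sliceProb N t ^ 2 * E) := by ring
    _ ≤ (|S| + |S'|) * (sliceProb N t ^ 2 * E) := mul_le_mul_of_nonneg_right h5 h6
    _ = _ := by ring

end ThresholdSets

/-! ### Pointwise bound for the centred correlation. -/

section CorrelationBound

theorem expect_exp_div_sqrt_le {d : ℕ} (hd : 0 < d) (a : ℝ) :
    𝔼 x : Hypercube d, Real.exp (a * (|coordSum x| / √d)) ≤ 2 * Real.exp (a ^ 2 / 2) := by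
  have hd' : (0 : ℝ) < d := by exact_mod_cast hd
  have h := expect_exp_abs_coordSum_le d (a / √d)
  have hsq : √(d : ℝ) ^ 2 = d := Real.sq_sqrt hd'.le
  have e : (a / √d) ^ 2 * d / 2 = a ^ 2 / 2 := by
    rw [div_pow, hsq]; field_simp
  rw [e] at h
  refine le_trans (le_of_eq (Finset.expect_congr rfl fun x _ => ?_)) h
  congr 1
  ring

/-- Constant governing the relative change of slice correlations, for densities at most `c`. -/
noncomputable def rateConst (c : ℝ) : ℝ := 16 + 256 * (1 - Real.log (1 - c))

theorem le_rateConst {c : ℝ} (hc0 : 0 ≤ c) (hc : c < 1) : 272 ≤ rateConst c := by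
  have := Real.log_nonpos (show 0 ≤ 1 - c by linarith) (by linarith)
  unfold rateConst
  linarith

/-- The rate is O(L/d), so with L ≤ √d the fixed offset of order √N costs only a constant in the
exponent; what remains is linear in v. -/
theorem sliceRate_mul_le {N t : ℕ} {c L : ℝ} (hc0 : 0 ≤ c) (hc : c < 1) (hL : 1 ≤ L)
    (hLd : L ≤ √(N + 1 : ℕ)) (hN : 144 ≤ N)
    (hb : ((N : ℝ) - 2 * t) ^ 2 ≤ 2 * (1 - Real.log (1 - c)) * (N + 1 : ℕ) * L) {v : ℝ}
    (hv : 0 ≤ v) :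
    sliceRate N t * ((v + 1 + 3 * √N) / 4) ≤
      rateConst c + rateConst c * L / (N + 1 : ℕ) * v := by
  have hlog := Real.log_nonpos (show 0 ≤ 1 - c by linarith) (by linarith)
  set K₀ := 1 - Real.log (1 - c) with hK₀
  have hK₀1 : 1 ≤ K₀ := by linarith
  have hN' : (144 : ℝ) ≤ N := by exact_mod_cast hN
  set D : ℝ := ((N + 1 : ℕ) : ℝ) with hD
  have hDN : D = N + 1 := by rw [hD]; push_cast; rfl
  have hND : D / 2 ≤ N := by linarith
  have hD0 : 0 < D := by linarith
  have hsq : √D ^ 2 = D := Real.sq_sqrt hD0.le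
  have hs0 : 0 < √D := Real.sqrt_pos.2 hD0
  have hε : sliceRate N t ≤ rateConst c * L / D := by
    have h1 : 8 / (N : ℝ) ≤ 16 * L / D := by
      rw [div_le_div_iff₀ (by linarith) hD0]
      calc 8 * D ≤ 16 * 1 * N := by linarith
        _ ≤ 16 * L * N := by gcongr
    have h2 : 32 * ((N : ℝ) - 2 * t) ^ 2 / (N : ℝ) ^ 2 ≤ 256 * K₀ * L / D := by
      calc 32 * ((N : ℝ) - 2 * t) ^ 2 / (N : ℝ) ^ 2 ≤ 32 * (2 * K₀ * D * L) / (D / 2) ^ 2 := by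
            gcongr
        _ = _ := by field_simp; ring
    unfold sliceRate rateConst
    calc _ ≤ 16 * L / D + 256 * K₀ * L / D := add_le_add h1 h2
      _ = _ := by ring
  have hR : 0 ≤ rateConst c * L / D := by
    have := le_rateConst hc0 hc
    positivity
  have hsN : √(N : ℝ) ≤ √D := Real.sqrt_le_sqrt (by linarith)
  have h1s : 1 ≤ √D := Real.one_le_sqrt.2 (by linarith)
  calc sliceRate N t * ((v + 1 + 3 * √N) / 4) ≤ rateConst c * L / D * (√D + v) := by
        refine mul_le_mul hε ?_ (by positivity) hR
        linarith
    _ = rateConst c * (L * √D / D) + rateConst c * L / D * v := by ring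
    _ ≤ _ := by
        have : L * √D / D ≤ 1 := by
          rw [div_le_one hD0]
          calc L * √D ≤ √D * √D := by gcongr
            _ = D := by rw [← sq, hsq]
        have h3 := le_rateConst hc0 hc
        have := mul_le_mul_of_nonneg_left this (by linarith : 0 ≤ rateConst c)
        linarith

/-- Constant in the pointwise bound for correlations of a threshold set and its translates. -/
noncomputable def corrConst (c : ℝ) : ℝ :=
  16 * Real.exp (rateConst c + (rateConst c + 1) ^ 2 / 2) + 1

theorem corrConst_pos (c : ℝ) : 0 < corrConst c := by unfold corrConst; positivity

theorem abs_ballPair_sub_sq_le {N t : ℕ} {p c : ℝ} (hp : ballProb (N + 1) t = p) (hp0 : 0 < p)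
    (hpc : p ≤ c) (hc : c < 1) (hd : rateConst c ≤ √(N + 1 : ℕ))
    (hLd : 1 - Real.log p ≤ √(N + 1 : ℕ))
    (htail : 2 * Real.exp (-((N + 1 : ℕ) / 128)) ≤ p ^ 2 / √(N + 1 : ℕ))
    (g : Hypercube (N + 1)) (hg : |coordSum g| ≤ (N + 1 : ℕ) / 8) :
    |ballPair (N + 1) t (negCount g) - p ^ 2| ≤
      corrConst c * p ^ 2 * ((1 - Real.log p) / √(N + 1 : ℕ)) * (|coordSum g| / √(N + 1 : ℕ) + 1) *
        Real.exp (rateConst c * (1 - Real.log p) / (N + 1 : ℕ) * |coordSum g|) := by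
  classical
  have hc0 : 0 ≤ c := by linarith
  have hK := le_rateConst hc0 hc
  have hb := sq_threshold_le (Nat.succ_pos N) hp hp0 hpc hc
  have hs2 := sliceProb_sq_le hp hp0 (hpc.trans_lt hc)
  have hL : 1 ≤ 1 - Real.log p := by linarith [Real.log_nonpos hp0.le (by linarith)]
  set L := 1 - Real.log p with hLdef
  set K := rateConst c with hKdef
  set D : ℝ := ((N + 1 : ℕ) : ℝ) with hD
  have hDN : D = N + 1 := by rw [hD]; push_cast; rfl
  have hs0 : 0 < √D := by linarith
  have hD0 : 0 < D := Real.sqrt_pos.1 hs0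
  have hsq : √D ^ 2 = D := Real.sq_sqrt hD0.le
  have hD1 : 272 ^ 2 ≤ D := by
    rw [← hsq]; exact pow_le_pow_left₀ (by norm_num) (by linarith) 2
  have hN : 144 ≤ N := by
    have : (144 : ℝ) ≤ N := by linarith
    exact_mod_cast this
  have hb' : ((N : ℝ) - 2 * t) ^ 2 ≤ 2 * (1 - Real.log (1 - c)) * D * L := by
    refine le_trans (le_of_eq ?_) hb
    rw [hDN]; ring
  have hb32 : 32 * ((N : ℝ) - 2 * t) ^ 2 ≤ (N : ℝ) ^ 2 := by
    have h1 : 128 * (2 * (1 - Real.log (1 - c))) * (D * L) ≤ √D * (D * √D) := by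
      refine mul_le_mul ?_ ?_ (by positivity) hs0.le
      · have : 128 * (2 * (1 - Real.log (1 - c))) ≤ K := by
          rw [hKdef, rateConst]; linarith
        linarith
      · gcongr
    have h2 : √D * (D * √D) = D ^ 2 := by
      calc √D * (D * √D) = √D ^ 2 * D := by ring
        _ = _ := by rw [hsq]; ring
    have h3 : (D / 2) ^ 2 ≤ (N : ℝ) ^ 2 := pow_le_pow_left₀ (by linarith) (by linarith) 2
    linarith
  set w := |coordSum g| / √D with hw
  have hw0 : 0 ≤ w := by positivity
  set E := Real.exp (K * L / D * |coordSum g|) with hE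
  have hE1 : 1 ≤ E := Real.one_le_exp (by positivity)
  -- Outside |S'| < D/8 smoothness is unavailable; the trivial bound 1 then costs only a tail, which
  -- `htail` makes at most p²/√D.
  have hpt : ∀ g' : Hypercube (N + 1),
      |ballPair (N + 1) t (negCount g) - ballPair (N + 1) t (negCount g')| ≤
        8 * p ^ 2 * (L / √D) * (w + 1) * E * Real.exp K *
          Real.exp ((K + 1) * (|coordSum g'| / √D)) +
          if D / 8 ≤ |coordSum g'| then (1 : ℝ) else 0 := by
    intro g'
    set S' := |coordSum g'| with hS'
    have hS0 : 0 ≤ S' := abs_nonneg _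
    by_cases hg' : D / 8 ≤ S'
    · rw [if_pos hg']
      have h1 := ballPair_nonneg t g
      have h2 := ballPair_nonneg t g'
      have h3 := ballPair_le t g
      have h4 := ballPair_le t g'
      rw [hp] at h3 h4
      have h5 : |ballPair (N + 1) t (negCount g) - ballPair (N + 1) t (negCount g')| ≤ 1 := by
        rw [abs_le]; constructor <;> linarith
      refine h5.trans (le_add_of_nonneg_left ?_)
      positivity
    · rw [if_neg hg', add_zero]
      refine (abs_ballPair_sub_le hN hb32 g g' hg (not_le.1 hg').le).trans ?_
      have hex : Real.exp (sliceRate N t * ((|coordSum g| + |coordSum g'| + 1 + 3 * √N) / 4)) ≤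
          Real.exp K * E * Real.exp (K * (S' / √D)) := by
        rw [hE, ← Real.exp_add, ← Real.exp_add]
        refine Real.exp_le_exp.2 ?_
        refine (sliceRate_mul_le hc0 hc hL hLd hN hb' (v := |coordSum g| + |coordSum g'|)
          (by positivity)).trans ?_
        have h6 : L / D * S' ≤ S' / √D := by
          rw [div_mul_eq_mul_div, div_le_div_iff₀ hD0 hs0]
          calc L * S' * √D ≤ √D * S' * √D := by gcongr
            _ = S' * √D ^ 2 := by ring
            _ = _ := by rw [hsq]
        have h7 := mul_le_mul_of_nonneg_left h6 (by linarith : 0 ≤ K)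
        calc K + K * L / D * (|coordSum g| + S') =
            K + K * L / D * |coordSum g| + K * (L / D * S') := by ring
          _ ≤ _ := by linarith
      have hh : sliceProb N t ^ 2 ≤ 8 * p ^ 2 * L / D := by
        rw [le_div_iff₀ hD0]; exact hs2
      have hsum : |coordSum g| + S' ≤ √D * ((w + 1) * Real.exp (S' / √D)) := by
        have h8 : S' / √D + 1 ≤ Real.exp (S' / √D) := Real.add_one_le_exp _
        have h9 : 0 ≤ S' / √D := by positivity
        have h10 : |coordSum g| + S' = √D * (w + S' / √D) := by
          rw [hw]; field_simp
        rw [h10]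
        refine mul_le_mul_of_nonneg_left ?_ hs0.le
        calc w + S' / √D ≤ (w + 1) * (S' / √D + 1) := by
              have := mul_nonneg hw0 h9
              linarith
          _ ≤ _ := by gcongr
      calc (|coordSum g| + S') * sliceProb N t ^ 2 *
            Real.exp (sliceRate N t * ((|coordSum g| + |coordSum g'| + 1 + 3 * √N) / 4))
          ≤ (√D * ((w + 1) * Real.exp (S' / √D))) * (8 * p ^ 2 * L / D) *
            (Real.exp K * E * Real.exp (K * (S' / √D))) := by gcongr
        _ = 8 * p ^ 2 * (L * √D / D) * (w + 1) * E * Real.exp K *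
            (Real.exp (K * (S' / √D)) * Real.exp (S' / √D)) := by ring
        _ = _ := by
            rw [← Real.exp_add]
            have e1 : L * √D / D = L / √D := by
              rw [div_eq_div_iff hD0.ne' hs0.ne', mul_assoc, ← sq, hsq]
            rw [e1]
            congr 2
            ring
  -- As p² is the mean correlation, centring is averaging the differences over an independent g'.
  have hmean : ballPair (N + 1) t (negCount g) - p ^ 2 = 𝔼 g' : Hypercube (N + 1),
      (ballPair (N + 1) t (negCount g) - ballPair (N + 1) t (negCount g')) := by
    rw [Finset.expect_sub_distrib, expect_ballPair, hp, Fintype.expect_const]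
  have htl := expect_le_abs_coordSum (d := N + 1) (by omega) (R := D / 8) (by positivity)
  rw [← hD] at htl
  have e2 : (D / 8) ^ 2 / (2 * D) = D / 128 := by field_simp; norm_num
  rw [e2] at htl
  have hm := expect_exp_div_sqrt_le (d := N + 1) (by omega) (K + 1)
  rw [← hD] at hm
  have hA : 0 ≤ 8 * p ^ 2 * (L / √D) * (w + 1) * E * Real.exp K := by positivity
  rw [hmean]
  calc |𝔼 g' : Hypercube (N + 1),
      (ballPair (N + 1) t (negCount g) - ballPair (N + 1) t (negCount g'))|
      ≤ 𝔼 g' : Hypercube (N + 1),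
      |ballPair (N + 1) t (negCount g) - ballPair (N + 1) t (negCount g')| :=
        Finset.abs_expect_le _ _
    _ ≤ 8 * p ^ 2 * (L / √D) * (w + 1) * E * Real.exp K * (2 * Real.exp ((K + 1) ^ 2 / 2)) +
        p ^ 2 / √D := by
        refine (Finset.expect_le_expect fun g' _ => hpt g').trans ?_
        rw [Finset.expect_add_distrib, ← Finset.mul_expect]
        exact add_le_add (mul_le_mul_of_nonneg_left hm hA) (htl.trans htail)
    _ ≤ 8 * p ^ 2 * (L / √D) * (w + 1) * E * Real.exp K * (2 * Real.exp ((K + 1) ^ 2 / 2)) +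
        p ^ 2 * (L / √D) * (w + 1) * E := by
        have : p ^ 2 / √D = p ^ 2 * (1 / √D) * 1 * 1 := by ring
        rw [this]
        gcongr
        linarith
    _ = _ := by
        -- In `corrConst`, 16 = 8 · 2 comes from the level-one bound and the two-sided moment; the
        -- `+ 1` absorbs the tail.
        rw [corrConst, ← hKdef, Real.exp_add]
        ring

end CorrelationBound

/-! ### Second-order bound for E(1 + X)^k. -/

section MomentBound

/-- The linear term is kept exact so that it vanishes in expectation. -/
theorem exp_le_one_add_add_sq (y : ℝ) : Real.exp y ≤ 1 + y + y ^ 2 * Real.exp |y| := by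
  have h1 : Real.exp y - 1 ≤ y * Real.exp y := by
    have h := Real.add_one_le_exp (-y)
    have h2 : Real.exp (-y) * Real.exp y = 1 := by rw [← Real.exp_add]; simp
    have := mul_le_mul_of_nonneg_right h (Real.exp_pos y).le
    linarith
  have h2 := Real.add_one_le_exp y
  rcases le_total 0 y with hy | hy
  · rw [abs_of_nonneg hy]
    have := mul_le_mul_of_nonneg_left h1 hy
    have e : y * (y * Real.exp y) = y ^ 2 * Real.exp y := by ring
    linarith
  · have h3 : 1 ≤ Real.exp |y| := Real.one_le_exp (abs_nonneg _)
    have h4 : 0 ≤ (-y) * (Real.exp y - 1 - y) := mul_nonneg (by linarith) (by linarith)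
    have h5 := mul_le_mul_of_nonneg_left h3 (sq_nonneg y)
    linarith

/-- Exponent in the moment bound. -/
noncomputable def momentExp (c : ℝ) : ℝ := 2 + 2 * rateConst c + 5 * (corrConst c / (1 - c))

/-- Constant in the moment bound. -/
noncomputable def momentConst (c : ℝ) : ℝ :=
  2 * ((corrConst c / (1 - c)) ^ 2 * Real.exp (5 * (corrConst c / (1 - c)))) *
    Real.exp (momentExp c ^ 2 / 2)

/-- The lower bound uses x ≥ 0 when p ≤ 1/2 and x ≥ 2p − 1 when p ≥ 1/2. It keeps 1 + X in [0, 2],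
as the crude estimate on atypical g requires. -/
theorem abs_sub_sq_div_le {p x : ℝ} (hp0 : 0 < p) (hp1 : p < 1) (h0 : 0 ≤ x) (h1 : x ≤ p)
    (h2 : 2 * p - 1 ≤ x) : |(x - p ^ 2) / (p * (1 - p))| ≤ 1 := by
  have hpp : 0 < p * (1 - p) := mul_pos hp0 (by linarith)
  rw [abs_le, le_div_iff₀ hpp, div_le_iff₀ hpp]
  constructor
  · rcases le_total p (1 / 2) with h | h
    · have := mul_nonneg hp0.le (by linarith : 0 ≤ 1 - 2 * p)
      linarith
    · have := mul_nonneg (by linarith : 0 ≤ 1 - p) (by linarith : 0 ≤ 2 * p - 1)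
      linarith
  · linarith

/-- Squaring and using L² ≤ 8e^{L/2} and e^L p = e leaves 8e · n²p/D. Moreover (n²p)² = n · n³p² ≤
D², so the square is at most 8e ≤ 25. -/
theorem small_scale_le {n p L D : ℝ} (hn : 0 ≤ n) (hp0 : 0 < p) (hL : L = 1 - Real.log p)
    (hL1 : 1 ≤ L) (hnD : n ≤ D) (hnp : n ^ 3 * p ^ 2 * L ^ 2 ≤ D) (hD : 0 < D) :
    n * (p * (L / √D) * Real.exp (L / 4)) ≤ 5 := by
  have hsq : √D ^ 2 = D := Real.sq_sqrt hD.le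
  have h1 : L ^ 2 ≤ 8 * Real.exp (L / 2) := by
    have := Real.quadratic_le_exp_of_nonneg (show 0 ≤ L / 2 by linarith)
    linarith
  have h2 : Real.exp (L / 4) ^ 2 = Real.exp (L / 2) := by
    rw [sq, ← Real.exp_add]; ring_nf
  have h3 : Real.exp (L / 2) * Real.exp (L / 2) * p = Real.exp 1 := by
    calc Real.exp (L / 2) * Real.exp (L / 2) * p =
        Real.exp (L / 2) * Real.exp (L / 2) * Real.exp (Real.log p) := by rw [Real.exp_log hp0]
      _ = _ := by rw [← Real.exp_add, ← Real.exp_add, hL]; ring_nf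
  have h4 : n ^ 2 * p ≤ D := by
    refine abs_le_of_sq_le_sq' ?_ hD.le |>.2
    have h5 : n ^ 3 * p ^ 2 ≤ D := by
      refine le_trans ?_ hnp
      have : 1 ≤ L ^ 2 := one_le_pow₀ hL1
      exact le_mul_of_one_le_right (by positivity) this
    calc (n ^ 2 * p) ^ 2 = n * (n ^ 3 * p ^ 2) := by ring
      _ ≤ D * D := mul_le_mul hnD h5 (by positivity) hD.le
      _ = D ^ 2 := by ring
  refine abs_le_of_sq_le_sq' ?_ (by norm_num) |>.2
  calc (n * (p * (L / √D) * Real.exp (L / 4))) ^ 2 =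
      n ^ 2 * p ^ 2 * L ^ 2 * Real.exp (L / 4) ^ 2 / √D ^ 2 := by ring
    _ ≤ n ^ 2 * p ^ 2 * (8 * Real.exp (L / 2)) * Real.exp (L / 2) / D := by
        rw [h2, hsq]; gcongr
    _ = 8 * (Real.exp (L / 2) * Real.exp (L / 2) * p) * (n ^ 2 * p) / D := by ring
    _ ≤ 8 * Real.exp 1 * D / D := by rw [h3]; gcongr
    _ = 8 * Real.exp 1 := by field_simp
    _ ≤ 5 ^ 2 := by linarith [Real.exp_one_lt_d9]

theorem expect_one_add_pow_le {N t n k : ℕ} {p c : ℝ} (hp : ballProb (N + 1) t = p) (hp0 : 0 < p)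
    (hpc : p ≤ c) (hc : c < 1) (hd : rateConst c ≤ √(N + 1 : ℕ))
    (hLd : 1 - Real.log p ≤ √(N + 1 : ℕ))
    (htail : 2 * Real.exp (-((N + 1 : ℕ) / 128)) ≤ p ^ 2 / √(N + 1 : ℕ))
    (hnD : (n : ℝ) ≤ (N + 1 : ℕ))
    (hnp : (n : ℝ) ^ 3 * p ^ 2 * (1 - Real.log p) ^ 2 ≤ (N + 1 : ℕ)) (hk : k ≤ n) :
    𝔼 g : Hypercube (N + 1),
        (1 + (ballPair (N + 1) t (negCount g) - p ^ 2) / (p * (1 - p))) ^ k - 1 ≤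
      momentConst c * ((n : ℝ) ^ 2 * p ^ 2 * (1 - Real.log p) ^ 2 / (N + 1 : ℕ)) +
        (2 ^ n + n) * (2 * Real.exp (-((N + 1 : ℕ) / (32 * rateConst c ^ 2)))) := by
  classical
  have hc0 : 0 ≤ c := by linarith
  have hp1 : p < 1 := by linarith
  have hK := le_rateConst hc0 hc
  have hpt := abs_ballPair_sub_sq_le hp hp0 hpc hc hd hLd htail
  have hL1 : 1 ≤ 1 - Real.log p := by linarith [Real.log_nonpos hp0.le (by linarith)]
  set L := 1 - Real.log p with hL
  set K := rateConst c with hKdef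
  set D : ℝ := ((N + 1 : ℕ) : ℝ) with hD
  set X : Hypercube (N + 1) → ℝ := fun g =>
    (ballPair (N + 1) t (negCount g) - p ^ 2) / (p * (1 - p)) with hX
  have hs0 : 0 < √D := by linarith
  have hD0 : 0 < D := Real.sqrt_pos.1 hs0
  have hsq : √D ^ 2 = D := Real.sq_sqrt hD0.le
  have hmean : 𝔼 g, X g = 0 := by
    rw [hX, ← Finset.expect_div, Finset.expect_sub_distrib, expect_ballPair, hp,
      Fintype.expect_const]
    simp
  have hX1 : ∀ g, |X g| ≤ 1 := fun g => abs_sub_sq_div_le hp0 hp1 (ballPair_nonneg t g)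
    (hp ▸ ballPair_le t g) (hp ▸ le_ballPair t g)
  set Q := corrConst c / (1 - c) with hQ
  have hQ0 : 0 < Q := div_pos (corrConst_pos c) (by linarith)
  set A := momentExp c with hA
  set B := Q ^ 2 * Real.exp (5 * Q) * ((n : ℝ) ^ 2 * p ^ 2 * L ^ 2 / D) with hB
  have hB0 : 0 ≤ B := by positivity
  have hkn : (k : ℝ) ≤ n := by exact_mod_cast hk
  have hk0 : (0 : ℝ) ≤ k := by positivity
  -- The cutoff D/(4K) bounds the growth factor by e^{L/4}, exactly what `small_scale_le` absorbs.
  -- Then |kX| is at most linear in |Σ g_i|/√D, so its exponential stays integrable.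
  have key : ∀ g, (1 + X g) ^ k ≤ 1 + k * X g + (B * Real.exp (A * (|coordSum g| / √D)) +
      (2 ^ n + n) * if D / (4 * K) ≤ |coordSum g| then (1 : ℝ) else 0) := by
    intro g
    obtain ⟨x1, x2⟩ := abs_le.1 (hX1 g)
    by_cases hg : D / (4 * K) ≤ |coordSum g|
    · rw [if_pos hg]
      have h1 : (1 + X g) ^ k ≤ 2 ^ n :=
        (pow_le_pow_left₀ (by linarith) (by linarith) k).trans
          (pow_le_pow_right₀ (by norm_num) hk)
      have h2 : -(n : ℝ) ≤ k * X g := by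
        have := mul_le_mul_of_nonneg_left x1 hk0
        linarith
      have h3 : 0 ≤ B * Real.exp (A * (|coordSum g| / √D)) := by positivity
      linarith
    · rw [if_neg hg, mul_zero, add_zero]
      rw [not_le] at hg
      set w := |coordSum g| / √D with hw
      have hw0 : 0 ≤ w := by positivity
      set E := Real.exp (K * L / D * |coordSum g|) with hE
      have hg8 : |coordSum g| ≤ D / 8 := by
        refine hg.le.trans ?_
        gcongr
        linarith
      have hXle : |X g| ≤ Q * p * (L / √D) * (w + 1) * E := by
        have h1 := hpt g hg8
        rw [hX]
        simp only
        have hpp : 0 < p * (1 - p) := mul_pos hp0 (by linarith)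
        rw [abs_div, abs_of_pos hpp, div_le_iff₀ hpp]
        refine h1.trans ?_
        have h2 : corrConst c ≤ Q * (1 - p) := by
          rw [hQ, div_mul_eq_mul_div, le_div_iff₀ (by linarith)]
          exact mul_le_mul_of_nonneg_left (by linarith) (corrConst_pos c).le
        calc corrConst c * p ^ 2 * (L / √D) * (w + 1) * E
            ≤ Q * (1 - p) * p ^ 2 * (L / √D) * (w + 1) * E := by gcongr
          _ = _ := by ring
      have hE4 : E ≤ Real.exp (L / 4) := by
        rw [hE]
        refine Real.exp_le_exp.2 ?_
        calc K * L / D * |coordSum g| ≤ K * L / D * (D / (4 * K)) := by gcongr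
          _ = L / 4 := by field_simp
      have hEw : E ≤ Real.exp (K * w) := by
        rw [hE]
        refine Real.exp_le_exp.2 ?_
        rw [mul_div_assoc, mul_assoc]
        refine mul_le_mul_of_nonneg_left ?_ (by linarith)
        rw [hw, div_mul_eq_mul_div, div_le_div_iff₀ hD0 hs0]
        calc L * |coordSum g| * √D ≤ √D * |coordSum g| * √D := by gcongr
          _ = |coordSum g| * √D ^ 2 := by ring
          _ = _ := by rw [hsq]
      have hY : |(k : ℝ) * X g| ≤ n * (Q * p * (L / √D) * (w + 1) * E) := by
        rw [abs_mul, abs_of_nonneg hk0]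
        gcongr
      have hY5 : |(k : ℝ) * X g| ≤ 5 * Q * (w + 1) := by
        refine hY.trans ?_
        have hss := small_scale_le (n := (n : ℝ)) (by positivity) hp0 hL hL1 hnD hnp hD0
        calc n * (Q * p * (L / √D) * (w + 1) * E)
            ≤ n * (Q * p * (L / √D) * (w + 1) * Real.exp (L / 4)) := by gcongr
          _ = (n * (p * (L / √D) * Real.exp (L / 4))) * (Q * (w + 1)) := by ring
          _ ≤ 5 * (Q * (w + 1)) := by gcongr
          _ = _ := by ring
      have hw1 : w + 1 ≤ Real.exp w := Real.add_one_le_exp w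
      -- The exponent 2 + 2K comes from squaring (w + 1)E; `momentExp` adds the 5Q from e^{|kX|}.
      have hYsq : ((k : ℝ) * X g) ^ 2 ≤
          Q ^ 2 * ((n : ℝ) ^ 2 * p ^ 2 * L ^ 2 / D) * Real.exp ((2 + 2 * K) * w) := by
        rw [← sq_abs]
        calc |(k : ℝ) * X g| ^ 2 ≤
            (n * (Q * p * (L / √D) * Real.exp w * Real.exp (K * w))) ^ 2 := by
              refine pow_le_pow_left₀ (abs_nonneg _) (hY.trans ?_) 2
              gcongr
          _ = Q ^ 2 * ((n : ℝ) ^ 2 * p ^ 2 * L ^ 2 / √D ^ 2) *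
              (Real.exp w * Real.exp w * (Real.exp (K * w) * Real.exp (K * w))) := by ring
          _ = _ := by
              rw [hsq, ← Real.exp_add, ← Real.exp_add, ← Real.exp_add]
              ring_nf
      calc (1 + X g) ^ k ≤ Real.exp (k * X g) := by
            rw [Real.exp_nat_mul]
            refine pow_le_pow_left₀ (by linarith) ?_ k
            linarith [Real.add_one_le_exp (X g)]
        _ ≤ 1 + k * X g + (k * X g) ^ 2 * Real.exp |k * X g| := exp_le_one_add_add_sq _
        _ ≤ 1 + k * X g + (Q ^ 2 * ((n : ℝ) ^ 2 * p ^ 2 * L ^ 2 / D) *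
            Real.exp ((2 + 2 * K) * w)) * Real.exp (5 * Q * (w + 1)) := by gcongr
        _ = 1 + k * X g + Q ^ 2 * ((n : ℝ) ^ 2 * p ^ 2 * L ^ 2 / D) *
            (Real.exp ((2 + 2 * K) * w) * Real.exp (5 * Q * (w + 1))) := by ring
        _ = 1 + k * X g + Q ^ 2 * ((n : ℝ) ^ 2 * p ^ 2 * L ^ 2 / D) *
            (Real.exp (5 * Q) * Real.exp (A * w)) := by
            rw [← Real.exp_add, ← Real.exp_add, hA, momentExp]
            congr 3
            ring
        _ = _ := by rw [hB]; ring
  have htl := expect_le_abs_coordSum (d := N + 1) (by omega) (R := D / (4 * K)) (by positivity)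
  rw [← hD] at htl
  have e2 : (D / (4 * K)) ^ 2 / (2 * D) = D / (32 * K ^ 2) := by field_simp; norm_num
  rw [e2] at htl
  have hm := expect_exp_div_sqrt_le (d := N + 1) (by omega) A
  rw [← hD] at hm
  have hsum := Finset.expect_le_expect (s := Finset.univ) fun g _ => key g
  rw [Finset.expect_add_distrib, Finset.expect_add_distrib, Finset.expect_add_distrib,
    ← Finset.mul_expect, ← Finset.mul_expect, ← Finset.mul_expect, hmean, Fintype.expect_const]
    at hsum
  have h1 := mul_le_mul_of_nonneg_left hm hB0
  have h2 := mul_le_mul_of_nonneg_left htl (show (0 : ℝ) ≤ 2 ^ n + n by positivity)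
  have h3 : B * (2 * Real.exp (A ^ 2 / 2)) =
      momentConst c * ((n : ℝ) ^ 2 * p ^ 2 * L ^ 2 / D) := by
    rw [hB, momentConst]; ring
  linarith

end MomentBound

/-! ### Explicit divergence bound for hard thresholds, and its asymptotics. -/

section HardThreshold

theorem klDiv_RAG_hardThreshold_le {d n : ℕ} {p : unitInterval} {τ c : ℝ}
    (hτ : IsThreshold d p τ) (hp0 : 0 < (p : ℝ)) (hpc : (p : ℝ) ≤ c) (hc : c < 1)
    (hd : rateConst c ≤ √d) (hLd : 1 - Real.log p ≤ √d)
    (htail : 2 * Real.exp (-(d / 128)) ≤ (p : ℝ) ^ 2 / √d) (hnD : (n : ℝ) ≤ d)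
    (hnp : (n : ℝ) ^ 3 * (p : ℝ) ^ 2 * (1 - Real.log p) ^ 2 ≤ d) :
    InformationTheory.klDiv (RAG n (hardThreshold d τ)) (SimpleGraph.binomialRandom (Fin n) p) ≤
      ENNReal.ofReal (momentConst c * ((n : ℝ) ^ 3 * (p : ℝ) ^ 2 * (1 - Real.log p) ^ 2 / d) +
        n * ((2 ^ n + n) * (2 * Real.exp (-(d / (32 * rateConst c ^ 2)))))) := by
  have hp1 : (p : ℝ) < 1 := hpc.trans_lt hc
  obtain ⟨t, htd, hT, hp⟩ := exists_hardThreshold_eq hτ hp0 hp1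
  obtain ⟨N, rfl⟩ : ∃ N, d = N + 1 := ⟨d - 1, by omega⟩
  have hσ : 𝔼 x, (hardThreshold (N + 1) τ x : ℝ) = p := by
    rw [← hp, ballProb]
    exact Finset.expect_congr rfl fun x _ => hT x
  refine (klDiv_RAG_le (hardThreshold (N + 1) τ) hp0 hp1 hσ n).trans (ENNReal.ofReal_le_ofReal ?_)
  have hcorr : ∀ g : Hypercube (N + 1), 𝔼 z, (hardThreshold (N + 1) τ z : ℝ) *
      hardThreshold (N + 1) τ (z * g) = ballPair (N + 1) t (negCount g) := by
    intro g
    rw [← expect_ball]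
    refine Finset.expect_congr rfl fun z _ => ?_
    rw [hT, hT]
    by_cases hz : negCount z ≤ t <;> simp [hz]
  simp_rw [hcorr]
  calc _ ≤ ∑ k ∈ Finset.range n, (momentConst c *
        ((n : ℝ) ^ 2 * (p : ℝ) ^ 2 * (1 - Real.log p) ^ 2 / (N + 1 : ℕ)) +
        (2 ^ n + n) * (2 * Real.exp (-((N + 1 : ℕ) / (32 * rateConst c ^ 2))))) :=
        Finset.sum_le_sum fun k hk => expect_one_add_pow_le hp hp0 hpc hc hd hLd htail hnD hnp
          (Finset.mem_range.1 hk).le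
    _ = _ := by
        rw [Finset.sum_const, Finset.card_range, nsmul_eq_mul]
        ring

theorem eventually_one_add_mul_log_le_sqrt (C : ℝ) :
    ∀ᶠ x : ℝ in atTop, 1 + C * Real.log x ≤ √x := by
  have h1 : (fun x : ℝ => 1 + C * Real.log x) =o[atTop] fun x : ℝ => x ^ (1 / 2 : ℝ) := by
    refine IsLittleO.add ?_ ((isLittleO_log_rpow_atTop (by norm_num)).const_mul_left C)
    exact isLittleO_const_left.2 (Or.inr (tendsto_norm_atTop_atTop.comp
      (tendsto_rpow_atTop (by norm_num))))
  filter_upwards [h1.bound one_pos, eventually_ge_atTop 0] with x hx hx0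
  rw [Real.sqrt_eq_rpow]
  rw [one_mul, Real.norm_of_nonneg (Real.rpow_nonneg hx0 _)] at hx
  exact (le_abs_self _).trans hx

theorem eventually_exp_neg_le_rpow_div_sqrt (C : ℝ) :
    ∀ᶠ x : ℝ in atTop, 2 * Real.exp (-(x / 128)) ≤ (x ^ (-C)) ^ 2 / √x := by
  have h := (tendsto_rpow_mul_exp_neg_mul_atTop_nhds_zero (2 * C + 1 / 2) (1 / 128)
    (by norm_num)).eventually_le_const (show (0 : ℝ) < 1 / 2 by norm_num)
  filter_upwards [h, eventually_gt_atTop 0] with x hx hx0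
  have e : (x ^ (-C)) ^ 2 / √x = (x ^ (2 * C + 1 / 2))⁻¹ := by
    rw [Real.sqrt_eq_rpow, ← Real.rpow_natCast, ← Real.rpow_mul hx0.le, ← Real.rpow_sub hx0,
      ← Real.rpow_neg hx0.le]
    congr 1
    push_cast
    ring
  rw [e, ← one_div, le_div_iff₀ (Real.rpow_pos_of_pos hx0 _)]
  have e2 : -(1 / 128) * x = -(x / 128) := by ring
  rw [e2] at hx
  linarith

/-- The role of d = Ω(n log n): it makes d/n tend to infinity, so d eventually exceeds any multiple
of n. -/
theorem eventually_mul_le_of_isBigO {d : ℕ → ℕ}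
    (hd : (fun n : ℕ => (n : ℝ) * Real.log n) =O[atTop] fun n => (d n : ℝ)) (A : ℝ) :
    ∀ᶠ n : ℕ in atTop, A * n ≤ d n := by
  obtain ⟨C, hC, h⟩ := hd.exists_pos
  have hlog : Tendsto (fun n : ℕ => Real.log n) atTop atTop :=
    Real.tendsto_log_atTop.comp tendsto_natCast_atTop_atTop
  filter_upwards [h.bound, hlog.eventually_ge_atTop (A * C)] with n h1 h2
  rw [Real.norm_of_nonneg (Nat.cast_nonneg (d n))] at h1
  have h3 := (le_abs_self _).trans h1
  have h4 : (n : ℝ) * (A * C) ≤ n * Real.log n := mul_le_mul_of_nonneg_left h2 (Nat.cast_nonneg n)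
  refine le_of_mul_le_mul_left ?_ hC
  linarith

theorem tendsto_two_pow_mul_exp_neg {d : ℕ → ℕ}
    (hd : (fun n : ℕ => (n : ℝ) * Real.log n) =O[atTop] fun n => (d n : ℝ)) {K : ℝ} (hK : 0 < K) :
    Tendsto (fun n : ℕ => (n : ℝ) * ((2 ^ n + n) * (2 * Real.exp (-(d n / K))))) atTop (𝓝 0) := by
  have hlim : Tendsto (fun n : ℕ => 4 * Real.exp (-(n : ℝ))) atTop (𝓝 0) := by
    have := (Real.tendsto_exp_neg_atTop_nhds_zero.comp tendsto_natCast_atTop_atTop).const_mul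
      (4 : ℝ)
    simpa using this
  refine squeeze_zero' (Eventually.of_forall fun n => by positivity) ?_ hlim
  filter_upwards [eventually_mul_le_of_isBigO hd (4 * K)] with n hn
  have h2 : (2 : ℝ) ^ n ≤ Real.exp n := by
    have : (2 : ℝ) ≤ Real.exp 1 := by linarith [Real.add_one_le_exp (1 : ℝ)]
    calc (2 : ℝ) ^ n ≤ Real.exp 1 ^ n := by gcongr
      _ = _ := by rw [← Real.exp_nat_mul, mul_one]
  have hn' : (n : ℝ) ≤ Real.exp n := by linarith [Real.add_one_le_exp (n : ℝ)]
  have h4 : Real.exp (-(d n / K)) ≤ Real.exp (-(4 * n)) := by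
    refine Real.exp_le_exp.2 (neg_le_neg ?_)
    rw [le_div_iff₀ hK]
    linarith
  calc (n : ℝ) * ((2 ^ n + n) * (2 * Real.exp (-(d n / K))))
      ≤ Real.exp n * ((Real.exp n + Real.exp n) * (2 * Real.exp (-(4 * n)))) := by gcongr
    _ = 4 * (Real.exp n * Real.exp n * Real.exp (-(4 * n))) := by ring
    _ ≤ 4 * Real.exp (-(n : ℝ)) := by
        rw [← Real.exp_add, ← Real.exp_add]
        gcongr
        linarith [Nat.cast_nonneg (α := ℝ) n]

end HardThreshold

theorem corollary4p6 (d : ℕ → ℕ) (p : ℕ → unitInterval) (τ : ℕ → ℝ)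
    -- `τ n` is the threshold defining the connection `T_p` on `{±1}^d`, with `p = p n`, `d = d n`
    (hτ : ∀ n, IsThreshold (d n) (p n) (τ n))
    -- `d = Ω(n log n)`
    (hd₁ : (fun n : ℕ => (n : ℝ) * Real.log n) =O[atTop] fun n => (d n : ℝ))
    -- `d = ω(n³ p² log² (1 / p))`
    (hd₂ : (fun n : ℕ => (n : ℝ) ^ 3 * (p n : ℝ) ^ 2 * Real.log (1 / (p n : ℝ)) ^ 2)
      =o[atTop] fun n => (d n : ℝ))
    -- `p` is polynomially bounded (below) in `d`
    (hp₀ : ∃ C : ℝ, ∀ᶠ n in atTop, (d n : ℝ) ^ (-C) ≤ (p n : ℝ))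
    -- `p` is bounded away from `1`
    (hp₁ : ∃ c : ℝ, c < 1 ∧ ∀ᶠ n in atTop, (p n : ℝ) ≤ c) :
    Tendsto (fun n : ℕ => InformationTheory.klDiv
      (RAG n (hardThreshold (d n) (τ n))) (SimpleGraph.binomialRandom (Fin n) (p n)))
      atTop (𝓝 0) := by
  obtain ⟨C, hC⟩ := hp₀
  obtain ⟨c₀, hc₀, hpc₀⟩ := hp₁
  -- Enlarging the bound to at least 1/2 keeps c positive, so that log c is genuinely negative.
  obtain ⟨c, hc, hc2, hpc⟩ : ∃ c : ℝ, c < 1 ∧ 1 / 2 ≤ c ∧ ∀ᶠ n in atTop, (p n : ℝ) ≤ c :=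
    ⟨max c₀ (1 / 2), max_lt hc₀ (by norm_num), le_max_right _ _,
      hpc₀.mono fun n hn => hn.trans (le_max_left _ _)⟩
  have hdn : ∀ᶠ n : ℕ in atTop, (n : ℝ) ≤ d n := by
    filter_upwards [eventually_mul_le_of_isBigO hd₁ 1] with n hn
    linarith
  have hdtop : Tendsto (fun n => (d n : ℝ)) atTop atTop :=
    tendsto_atTop_mono' _ hdn tendsto_natCast_atTop_atTop
  have hpos : ∀ᶠ n in atTop, 0 < (p n : ℝ) := by
    filter_upwards [hC, hdtop.eventually_gt_atTop 0] with n hn hd0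
    exact (Real.rpow_pos_of_pos hd0 _).trans_le hn
  have hlc : 0 < -Real.log c := by
    linarith [Real.log_neg (show 0 < c by linarith) hc]
  -- Since p ≤ c < 1, log(1/p) is bounded below, so 1 − log p is at most a constant multiple of it.
  have hO : (fun n : ℕ => (n : ℝ) ^ 3 * (p n : ℝ) ^ 2 * (1 - Real.log (p n)) ^ 2) =o[atTop]
      fun n => (d n : ℝ) := by
    refine IsBigO.trans_isLittleO (IsBigO.of_bound ((1 / -Real.log c + 1) ^ 2) ?_) hd₂
    filter_upwards [hpc, hpos] with n hn h0
    have hlp : -Real.log c ≤ -Real.log (p n) := neg_le_neg (Real.log_le_log h0 hn)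
    have h1 : 1 - Real.log (p n) ≤ (1 / -Real.log c + 1) * -Real.log (p n) := by
      have : 1 ≤ 1 / -Real.log c * -Real.log (p n) := by
        rw [div_mul_eq_mul_div, one_mul, le_div_iff₀ hlc]
        linarith
      linarith
    rw [one_div (p n : ℝ), Real.log_inv, Real.norm_of_nonneg (by positivity),
      Real.norm_of_nonneg (by positivity)]
    calc (n : ℝ) ^ 3 * (p n : ℝ) ^ 2 * (1 - Real.log (p n)) ^ 2
        ≤ (n : ℝ) ^ 3 * (p n : ℝ) ^ 2 * ((1 / -Real.log c + 1) * -Real.log (p n)) ^ 2 := by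
          gcongr
          linarith
      _ = _ := by ring
  have hbound : Tendsto (fun n : ℕ => ENNReal.ofReal (momentConst c *
      ((n : ℝ) ^ 3 * (p n : ℝ) ^ 2 * (1 - Real.log (p n)) ^ 2 / d n) +
        n * ((2 ^ n + n) * (2 * Real.exp (-(d n / (32 * rateConst c ^ 2))))))) atTop (𝓝 0) := by
    have hK := le_rateConst (by linarith) hc
    have h1 := (hO.tendsto_div_nhds_zero.const_mul (momentConst c)).add
      (tendsto_two_pow_mul_exp_neg hd₁ (K := 32 * rateConst c ^ 2) (by positivity))
    rw [mul_zero, add_zero] at h1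
    simpa using ENNReal.tendsto_ofReal h1
  refine tendsto_of_tendsto_of_tendsto_of_le_of_le' tendsto_const_nhds hbound
    (Eventually.of_forall fun _ => zero_le) ?_
  have hsqrt : Tendsto (fun n => √(d n : ℝ)) atTop atTop := Real.tendsto_sqrt_atTop.comp hdtop
  -- Polynomial boundedness of p enters twice: 1 − log p ≤ 1 + C log d ≤ √d, and p²/√d dominates the
  -- tail 2e^{−d/128}.
  filter_upwards [hC, hpc, hpos, hdn, hO.bound one_pos, hsqrt.eventually_ge_atTop (rateConst c),
    hdtop.eventually (eventually_one_add_mul_log_le_sqrt C),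
    hdtop.eventually (eventually_exp_neg_le_rpow_div_sqrt C), hdtop.eventually_gt_atTop 0]
    with n h1 h2 h3 h4 h5 h6 h7 h8 h9
  have hr : 0 < (d n : ℝ) ^ (-C) := Real.rpow_pos_of_pos h9 _
  refine klDiv_RAG_hardThreshold_le (hτ n) h3 h2 hc h6 ?_ ?_ h4 ?_
  · have := Real.log_le_log hr h1
    rw [Real.log_rpow h9] at this
    linarith
  · refine h8.trans ?_
    gcongr
  · rw [one_mul, Real.norm_of_nonneg (Nat.cast_nonneg _)] at h5
    exact (le_abs_self _).trans h5
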